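/- Let $E=\mathbb R^n$ with a norm $\|\cdot\|$, let $\mathcal C\subset E$ be a nonempty polytope with vertex set $\mathrm{Ext}(\mathcal C)$, and let $f:E\to\mathbb R$ be convex and differentiable with Lipschitz gradient on $\mathcal C+(\mathcal C-\mathcal C)$. Let $X^*$ be the set of minimizers of $f$ over $\mathcal C$ and $f^*=\min_{\mathcal C}f$. **Definitions.** For $x\in\mathcal C$ and a proper support $S$ of $x$ (a finite $S\subset \mathrm{Ext}(\mathcal C)$ such that $x$ is a convex combination of the points of $S$ with all weights positive) put $w(x,S)=\max_{y\in S,\,z\in\mathcal C}\nabla f(x)^T(y-z)$ and let $w(x)=\min_S w(x,S)$ over the proper supports of $x$. The away curvature is $$C_f^A=\sup_{x,s,v\in\mathcal C,\ \eta\in(0,1]}\tfrac{2}{\eta^2}\big(f(x+\eta(s-v))-f(x)-\eta\nabla f(x)^T(s-v)\big).$$ For $\delta>0$, $\mathcal C$ satisfies $\delta$-scaling if for every differentiable convex function $h:E\to\mathbb R$ (with $w$ and $X^*$ formed for $h$) and all $x\in\mathcal C\setminus X^*$, $x^*\in X^*$: $w(x)\ge\delta\,\nabla h(x)^T\frac{x-x^*}{\|x-x^*\|}$.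 For $\theta\in[0,1]$, $c>0$, $f$ satisfies $(\theta,c)$-HEB if $\min_{x^*\in X^*}\|x-x^*\|\le c\,(f(x)-f^*)^\theta$ for all $x\in\mathcal C$ (with $0^0=1$). *Fractional Away-Step Frank-Wolfe (FAFW)*, with parameter $\gamma>0$, starts from $x_0=\sum_{v\in\mathcal S_0}\alpha_0^v v$, where $\mathcal S_0\subset\mathrm{Ext}(\mathcal C)$ and the weights are positive with sum $1$. While $w(x_t,\mathcal S_t)>e^{-\gamma}w(x_0,\mathcal S_0)$ it takes a vertex $v_t\in\arg\min_{z\in\mathcal C}\nabla f(x_t)^Tz$ and $s_t\in\arg\max_{z\in\mathcal S_t}\nabla f(x_t)^Tz$; if $-\nabla f(x_t)^T(v_t-x_t)>e^{-\gamma}w(x_0,\mathcal S_0)/2$ it sets $d_t=v_t-x_t$, $\eta_{\max}=1$, otherwise $d_t=x_t-s_t$, $\eta_{\max}=\alpha_t^{s_t}/(1-\alpha_t^{s_t})$; it sets $x_{t+1}=x_t+\eta_td_t$ with $\eta_t$ an exact line-search minimizer on $[0,\eta_{\max}]$ and updates the weights accordingly ($\alpha\mapsto(1-\eta_t)\alpha+\eta_t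 e_{v_t}$, resp. $\alpha\mapsto(1+\eta_t)\alpha-\eta_te_{s_t}$), vertices of weight $0$ leaving the active set. The *restart scheme* with constant parameter $\gamma>0$ and accuracy $\epsilon>0$ calls FAFW repeatedly, each call starting at the output (point, active set, weights) of the previous one, as long as the current start of a call satisfies $w(x)>\epsilon$, and then outputs the current point. Iterations are counted cumulatively over all calls. **Statement.** Let $\gamma>0$. 1. There is $\delta>0$ such that $\mathcal C$ satisfies $\delta$-scaling. 2. For every $\epsilon>0$ the restart scheme terminates: there is an $N$ bounding the total number of iterations of all runs from all starting points, and from every starting point an output is reached. 3. Suppose $f$ satisfies $(\theta,c)$-HEB with $\theta\in[0,1]$, $c>0$, and $\mathcal C$ satisfies $\delta$-scaling with $\delta>0$; put $r=\frac1{1-\theta}$, $\mu=(c/\delta)^r$. Suppose that the starting point satisfies $e^{-\gamma}w_0/2\le C_f^A$, where $w_0=w(x_0,\mathcal S_0)$ (burn-in done). For every $\epsilon>0$, every output $x_T$ of the restart scheme, reached after $T$ iterations with active set $\mathcal S_T$, satisfies $$f(x_T)-f^*\le \frac{w_0}{\big(1+\tilde T\,C_\gamma^r\big)^{\frac1{2-r}}}\quad\text{if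 }1\le r<2,\qquad f(x_T)-f^*\le w_0\exp\Big(-\frac{\gamma}{e^{2\gamma}}\frac{\tilde T}{16\,C_f^A\mu}\Big)\quad\text{if }r=2,$$ where $\tilde T=\max\{0,\,T-(|\mathcal S_0|-|\mathcal S_T|)\}$ and $C_\gamma^r=\dfrac{e^{\gamma(2-r)}-1}{16\,e^{2\gamma}C_f^A\,\mu\,w_0^{r-2}}$ (if $w_0=0$ or $C_f^A=0$ then $w_0=0$ and both right-hand sides are read as $0$). 4. If $f$ is strongly convex on $\mathcal C$, then $f$ satisfies $(\frac12,c)$-HEB for some $c>0$ (so $r=2$), and the restart scheme converges linearly: there are $M$ and $\rho\in(0,1)$, depending only on $\mathcal C,f,\gamma$, such that for every accuracy $\epsilon>0$ and every starting point, without any burn-in assumption, every iterate $x_t$ (after $t$ iterations in total) satisfies $f(x_t)-f^*\le M\rho^t$. 5. Without further assumptions, $f$ satisfies $(0,c)$-HEB for some $c>0$ (so $r=1$), and the rate is $\mathcal O(1/t)$: there is $M$, depending only on $\mathcal C,f,\gamma$, such that for every accuracy $\epsilon>0$ and every starting point, without any burn-in assumption, every iterate $x_t$ with $t\ge1$ satisfies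 $f(x_t)-f^*\le M/t$. -/

import Mathlib

open Set Filter Topology
open scoped Pointwise NNReal

noncomputable section

namespace RestartFW

variable {E : Type*} [NormedAddCommGroup E] [NormedSpace ℝ E]

/-- A (nonempty) polytope: the convex hull of a nonempty finite set of points. -/
def IsPolytope (C : Set E) : Prop :=
  ∃ V : Finset E, V.Nonempty ∧ C = convexHull ℝ (V : Set E)

/-- A smooth convex function: `f` is convex and differentiable on the whole space and its gradient
is Lipschitz (from the given norm to the dual norm) on the Minkowski sum `C + (C - C)`, the set on
which the away curvature evaluates `f`. -/
structure IsSmoothConvex (C : Set E) (f : E → ℝ) : Prop where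
  convex : ConvexOn ℝ univ f
  differentiable : Differentiable ℝ f
  smooth : ∃ L : ℝ≥0, LipschitzOnWith L (fderiv ℝ f) (C + (C - C))

/-- The set `X*` of minimizers of `f` over `C`. -/
def minimizers (C : Set E) (f : E → ℝ) : Set E :=
  {x | x ∈ C ∧ IsMinOn f C x}

/-- The optimal value `f*` of `f` over `C`. -/
def optValue (C : Set E) (f : E → ℝ) : ℝ :=
  sInf (f '' C)

/-- `S` is a proper support of `x` in `C`: a finite set of extreme points of `C` such that `x` is a
convex combination of the elements of `S` with all weights positive. -/
def IsProperSupport (C : Set E) (x : E) (S : Finset E) : Prop :=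
  (S : Set E) ⊆ C.extremePoints ℝ ∧
    ∃ a : E → ℝ, (∀ v ∈ S, 0 < a v) ∧ ∑ v ∈ S, a v = 1 ∧ ∑ v ∈ S, a v • v = x

/-- `w(x, S) = max_{y ∈ S, z ∈ C} ⟨∇f(x), y - z⟩`. -/
def supportGap (C : Set E) (f : E → ℝ) (x : E) (S : Finset E) : ℝ :=
  sSup {a : ℝ | ∃ y ∈ S, ∃ z ∈ C, a = fderiv ℝ f x (y - z)}

/-- The strong Wolfe gap `w(x)`: the minimum of `w(x, S)` over the proper supports `S` of `x`. -/
def strongWolfeGap (C : Set E) (f : E → ℝ) (x : E) : ℝ :=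
  sInf {a : ℝ | ∃ S : Finset E, IsProperSupport C x S ∧ a = supportGap C f x S}

/-- The away curvature `C_f^A`. -/
def awayCurvature (C : Set E) (f : E → ℝ) : ℝ :=
  sSup {a : ℝ | ∃ x ∈ C, ∃ s ∈ C, ∃ v ∈ C, ∃ η ∈ Ioc (0 : ℝ) 1,
    a = 2 / η ^ 2 * (f (x + η • (s - v)) - f x - η * fderiv ℝ f x (s - v))}

/-- The `δ`-scaling inequality of `C`, for all differentiable convex functions. -/
def Scaling (C : Set E) (δ : ℝ) : Prop :=
  ∀ f : E → ℝ, ConvexOn ℝ univ f → Differentiable ℝ f →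
    ∀ x ∈ C \ minimizers C f, ∀ y ∈ minimizers C f,
      δ * fderiv ℝ f x (‖x - y‖⁻¹ • (x - y)) ≤ strongWolfeGap C f x

/-- The Hölderian error bound `(θ, c)`-HEB of `f` on `C`. -/
def HEB (C : Set E) (f : E → ℝ) (θ c : ℝ) : Prop :=
  ∀ x ∈ C, Metric.infDist x (minimizers C f) ≤ c * (f x - optValue C f) ^ θ

/-- The data carried by an iterate: a finitely supported weight function `α`, with support
`S ⊆ Ext(C)`, positive weights on `S`, and total weight one. -/
structure IsActiveRep (C : Set E) (α : E →₀ ℝ) : Prop where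
  extreme : ∀ v ∈ α.support, v ∈ C.extremePoints ℝ
  pos : ∀ v ∈ α.support, 0 < α v
  sum_eq_one : (α.sum fun _ a => a) = 1

/-- The iterate `x = ∑ α_v v` represented by the weights `α`. -/
def point (α : E →₀ ℝ) : E :=
  α.sum fun v a => a • v

/-- The observed gap `w(x, S)` of the iterate with weights `α` and active set `S = supp α`. -/
def gap (C : Set E) (f : E → ℝ) (α : E →₀ ℝ) : ℝ :=
  supportGap C f (point α) α.support

/-- `η` is an exact line-search step for `f` from `x` along `d` on `[0, ηmax]`. -/
def IsLineSearch (f : E → ℝ) (x d : E) (ηmax η : ℝ) : Prop :=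
  η ∈ Icc 0 ηmax ∧ IsMinOn (fun t : ℝ => f (x + t • d)) (Icc 0 ηmax) η

/-- One pass through the loop of the Fractional Away-Step Frank-Wolfe algorithm, where `W` is the
gap `w(x₀, S₀)` at the starting point of the call. The oracles and the line search may return any
optimal choice. Vertices whose weight becomes zero leave the active set. -/
def FracStep (C : Set E) (f : E → ℝ) (γ W : ℝ) (α α' : E →₀ ℝ) : Prop :=
  Real.exp (-γ) * W < gap C f α ∧
  ∃ v s : E, ∃ η : ℝ,
    (v ∈ C.extremePoints ℝ ∧ IsMinOn (fun z => fderiv ℝ f (point α) z) C v) ∧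
    (s ∈ α.support ∧ IsMaxOn (fun z => fderiv ℝ f (point α) z) (α.support : Set E) s) ∧
    ((Real.exp (-γ) * W / 2 < -(fderiv ℝ f (point α) (v - point α)) ∧
        IsLineSearch f (point α) (v - point α) 1 η ∧
        α' = (1 - η) • α + Finsupp.single v η) ∨
     (-(fderiv ℝ f (point α) (v - point α)) ≤ Real.exp (-γ) * W / 2 ∧
        IsLineSearch f (point α) (point α - s) (α s / (1 - α s)) η ∧
        α' = (1 + η) • α - Finsupp.single s η))

/-- `FracRun C f γ W α n β`: `n` passes of the loop, with reference gap `W`, lead from `α` to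
`β`. -/
inductive FracRun (C : Set E) (f : E → ℝ) (γ W : ℝ) (α : E →₀ ℝ) : ℕ → (E →₀ ℝ) → Prop
  | refl : FracRun C f γ W α 0 α
  | step {n : ℕ} {β β' : E →₀ ℝ} :
      FracRun C f γ W α n β → FracStep C f γ W β β' → FracRun C f γ W α (n + 1) β'

/-- The Fractional Away-Step Frank-Wolfe algorithm with parameter `γ`, started at `α`, stops after
`n` iterations with output `β`. -/
def FracOutput (C : Set E) (f : E → ℝ) (γ : ℝ) (α : E →₀ ℝ) (n : ℕ) (β : E →₀ ℝ) : Prop :=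
  FracRun C f γ (gap C f α) α n β ∧ gap C f β ≤ Real.exp (-γ) * gap C f α

/-- Restart scheme with constant parameter `γ` and accuracy `ε`: `RestartRun C f γ ε α₀ T α` says
that finitely many calls of the inner algorithm, `T` inner iterations in total, lead from `α₀` to
`α`; a new call is made only while `w(x) > ε`. -/
inductive RestartRun (C : Set E) (f : E → ℝ) (γ ε : ℝ) (α₀ : E →₀ ℝ) : ℕ → (E →₀ ℝ) → Prop
  | refl : RestartRun C f γ ε α₀ 0 α₀
  | restart {T n : ℕ} {α β : E →₀ ℝ} :
      RestartRun C f γ ε α₀ T α → ε < strongWolfeGap C f (point α) →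
      FracOutput C f γ α n β → RestartRun C f γ ε α₀ (T + n) β

/-- The restart scheme, started at `α₀`, stops with output `α` after `T` iterations in total. -/
def IsOutput (C : Set E) (f : E → ℝ) (γ ε : ℝ) (α₀ : E →₀ ℝ) (T : ℕ) (α : E →₀ ℝ) : Prop :=
  RestartRun C f γ ε α₀ T α ∧ strongWolfeGap C f (point α) ≤ ε

/-- `β` is an iterate of the restart scheme started at `α₀`, reached after `t` iterations in total;
this may be in the middle of a call of the inner algorithm. -/
def IsIterate (C : Set E) (f : E → ℝ) (γ ε : ℝ) (α₀ : E →₀ ℝ) (t : ℕ) (β : E →₀ ℝ) : Prop :=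
  RestartRun C f γ ε α₀ t β ∨
  ∃ (T n : ℕ) (α : E →₀ ℝ), RestartRun C f γ ε α₀ T α ∧ ε < strongWolfeGap C f (point α) ∧
    FracRun C f γ (gap C f α) α n β ∧ t = T + n

/-- `T̃ = T - (|S₀| - |S_T|)`, replaced by zero where it is negative. -/
def effectiveSteps (α₀ : E →₀ ℝ) (T : ℕ) (α : E →₀ ℝ) : ℝ :=
  max 0 ((T : ℝ) - ((α₀.support.card : ℝ) - (α.support.card : ℝ)))

/-- The constant `C_γ^r`, with `K = C_f^A`, `μ` the constant of the strong Wolfe primal bound and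
`w₀ = w(x₀, S₀)`. -/
def rateConst (γ r K μ w₀ : ℝ) : ℝ :=
  (Real.exp (γ * (2 - r)) - 1) / (16 * Real.exp (2 * γ) * K * μ * w₀ ^ (r - 2))

end RestartFW

end

open RestartFW

/-! In a call with reference gap `W`, put `Γ = e^{-γ} W / 2`. The gap `w(x, S)` is the sum of the
Frank-Wolfe gap and the away gap, so while it exceeds `2Γ` the chosen direction has slope at most
`-Γ`. With curvature bound `K ≥ Γ`, an unblocked line search then lowers `f` by at least `Γ² /
(2K)`. A blocked away step need not make progress, but it deletes a vertex, and no step adds more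
than one vertex. Hence iterations plus growth of the active set number at most twice the progress
steps (`FracStep.progress`, `FracRun.progress`).

On the other side, scaling, HEB and convexity give `f - f* ≤ μ w^r`
(`sub_optValue_le_strongWolfeGap_rpow`). The decrease available to a call is therefore at most `μ
W^r`, and its adjusted length at most `16 e^{2γ} K μ W^{r-2}` (`FracRun.iterations_le`). Each
completed call multiplies the gap by at most `e^{-γ}` and the cardinalities telescope, so induction
over the calls yields the rates (`RestartRun.rate_of_lt_two`, `RestartRun.rate_two`); the gap
dominates `f - f*`.

Scaling comes from Carathéodory's theorem for cones: `x - y` is a combination of differences of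
vertices with total weight `O(‖x - y‖)`. Burn-in is avoided in the global statements because `K` may
be any upper bound of the curvature and the gaps are bounded on `C`. -/

namespace RestartFW

/-! ### Conic combinations with controlled weights -/

/-- Carathéodory's theorem for cones: a conic combination of finitely many vectors is a conic
combination of linearly independent ones among them. -/
theorem exists_linearIndepOn_conic {ι F : Type*} [AddCommGroup F] [Module ℝ F] (g : ι → F)
    (t : Finset ι) (a : ι → ℝ) (ha : ∀ i ∈ t, 0 ≤ a i) :
    ∃ t' ⊆ t, ∃ b : ι → ℝ, (∀ i ∈ t', 0 ≤ b i) ∧ ∑ i ∈ t', b i • g i = ∑ i ∈ t, a i • g i ∧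
      LinearIndepOn ℝ g (t' : Set ι) := by
  classical
  induction t using Finset.strongInduction generalizing a with
  | H t ih =>
    by_cases hli : LinearIndepOn ℝ g (t : Set ι)
    · exact ⟨t, subset_rfl, a, ha, rfl, hli⟩
    obtain ⟨k, hk0, hkpos⟩ : ∃ k : ι → ℝ, ∑ i ∈ t, k i • g i = 0 ∧ ∃ i ∈ t, 0 < k i := by
      rw [linearIndepOn_finset_iff] at hli
      push Not at hli
      obtain ⟨k, hk0, i, hi, hki⟩ := hli
      rcases lt_or_gt_of_ne hki with h | h
      · exact ⟨fun j => -k j, by simp [hk0], i, hi, by simpa using h⟩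
      · exact ⟨k, hk0, i, hi, h⟩
    -- Ratio test: `a i₀ / k i₀` is the largest multiple of the relation `k` that can be subtracted
    -- with all weights staying nonnegative, and it makes the weight of `i₀` vanish.
    obtain ⟨i₀, hi₀, hmin⟩ : ∃ i₀ ∈ t.filter (fun i => 0 < k i),
        ∀ i ∈ t.filter (fun i => 0 < k i), a i₀ / k i₀ ≤ a i / k i := by
      obtain ⟨i, hi, hki⟩ := hkpos
      exact Finset.exists_min_image _ _ ⟨i, Finset.mem_filter.2 ⟨hi, hki⟩⟩
    obtain ⟨hi₀t, hki₀⟩ := Finset.mem_filter.1 hi₀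
    set q := a i₀ / k i₀ with hq
    have hq0 : 0 ≤ q := div_nonneg (ha _ hi₀t) hki₀.le
    obtain ⟨t', ht', b, hb, hsum, hind⟩ := ih (t.erase i₀) (Finset.erase_ssubset hi₀t)
      (fun i => a i - q * k i) (by
        intro i hi
        have hit := Finset.mem_of_mem_erase hi
        rcases lt_or_ge 0 (k i) with h | h
        · have := hmin i (Finset.mem_filter.2 ⟨hit, h⟩)
          rw [le_div_iff₀ h] at this
          linarith
        · have := mul_nonpos_of_nonneg_of_nonpos hq0 h
          have := ha i hit
          linarith)
    refine ⟨t', ht'.trans (Finset.erase_subset _ _), b, hb, ?_, hind⟩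
    have h0 : (a i₀ - q * k i₀) • g i₀ = 0 := by
      rw [hq, div_mul_cancel₀ _ hki₀.ne', sub_self, zero_smul]
    rw [hsum, Finset.sum_erase t h0]
    simp only [sub_smul, mul_smul, Finset.sum_sub_distrib, ← Finset.smul_sum, hk0, smul_zero,
      sub_zero]

variable {E : Type*} [NormedAddCommGroup E] [NormedSpace ℝ E]

/-- Independence makes the coefficient map injective on a finite-dimensional space, hence
antilipschitz. The cardinality of `t` is the cost of passing from the sup norm of the coefficients
to their sum. -/
theorem exists_sum_le_norm_of_linearIndepOn {ι : Type*} (g : ι → E) (t : Finset ι)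
    (h : LinearIndepOn ℝ g (t : Set ι)) :
    ∃ κ : ℝ, 0 ≤ κ ∧ ∀ b : ι → ℝ, ∑ i ∈ t, b i ≤ κ * ‖∑ i ∈ t, b i • g i‖ := by
  classical
  have hli : LinearIndependent ℝ (fun i : t => g i) := h
  obtain ⟨K, -, hK⟩ := LinearMap.exists_antilipschitzWith
    (Fintype.linearCombination ℝ (fun i : t => g i))
    (LinearMap.ker_eq_bot.2 (linearIndependent_iff_injective_fintypeLinearCombination.1 hli))
  refine ⟨t.card * K, by positivity, fun b => ?_⟩
  have h1 := hK.le_mul_norm_sub (fun i : t => b i) 0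
  rw [map_zero, add_zero, add_zero, norm_neg, norm_neg, Fintype.linearCombination_apply,
    Finset.sum_coe_sort t (fun i => b i • g i)] at h1
  calc ∑ i ∈ t, b i ≤ ∑ i ∈ t, K * ‖∑ i ∈ t, b i • g i‖ := by
        refine Finset.sum_le_sum fun i hi => le_trans ?_ h1
        exact (le_abs_self _).trans (norm_le_pi_norm (fun i : t => b i) ⟨i, hi⟩)
    _ = t.card * K * ‖∑ i ∈ t, b i • g i‖ := by
        rw [Finset.sum_const, nsmul_eq_mul, mul_assoc]

/-- Conic combinations of a finite family admit weights bounded by the norm of the result, uniformly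
over the subfamilies. -/
theorem exists_conic_weights_le {ι : Type*} (g : ι → E) (D : Finset ι) :
    ∃ κ : ℝ, 0 < κ ∧ ∀ t ⊆ D, ∀ a : ι → ℝ, (∀ i ∈ t, 0 ≤ a i) →
      ∃ t' ⊆ t, ∃ b : ι → ℝ, (∀ i ∈ t', 0 ≤ b i) ∧ ∑ i ∈ t', b i • g i = ∑ i ∈ t, a i • g i ∧
        ∑ i ∈ t', b i ≤ κ * ‖∑ i ∈ t, a i • g i‖ := by
  classical
  -- Each subfamily has its own constant, with `0` as a dummy for dependent ones. Since `D` has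
  -- finitely many subsets, the sum of the constants serves them all.
  have h : ∀ t : Finset ι, ∃ κ : ℝ, 0 ≤ κ ∧ (LinearIndepOn ℝ g (t : Set ι) →
      ∀ b : ι → ℝ, ∑ i ∈ t, b i ≤ κ * ‖∑ i ∈ t, b i • g i‖) := by
    intro t
    by_cases ht : LinearIndepOn ℝ g (t : Set ι)
    · obtain ⟨κ, h0, h1⟩ := exists_sum_le_norm_of_linearIndepOn g t ht
      exact ⟨κ, h0, fun _ => h1⟩
    · exact ⟨0, le_rfl, fun h => absurd h ht⟩
  choose κ hκ0 hκ using h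
  have hnn : 0 ≤ ∑ t ∈ D.powerset, κ t := Finset.sum_nonneg fun t _ => hκ0 t
  refine ⟨1 + ∑ t ∈ D.powerset, κ t, by linarith, fun t ht a ha => ?_⟩
  obtain ⟨t', ht', b, hb, hsum, hli⟩ := exists_linearIndepOn_conic g t a ha
  refine ⟨t', ht', b, hb, hsum, ?_⟩
  rw [← hsum]
  refine (hκ t' hli b).trans (mul_le_mul_of_nonneg_right ?_ (norm_nonneg _))
  have := Finset.single_le_sum (fun t _ => hκ0 t) (Finset.mem_powerset.2 (ht'.trans ht))
  linarith

/-! ### Polytopes and their vertices -/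

section Polytope

variable {C : Set E}

theorem IsPolytope.convex (hC : IsPolytope C) : Convex ℝ C := by
  obtain ⟨V, -, rfl⟩ := hC
  exact convex_convexHull ℝ _

theorem IsPolytope.isCompact (hC : IsPolytope C) : IsCompact C := by
  obtain ⟨V, -, rfl⟩ := hC
  exact V.finite_toSet.isCompact_convexHull ℝ

theorem IsPolytope.nonempty (hC : IsPolytope C) : C.Nonempty := by
  obtain ⟨V, hV, rfl⟩ := hC
  exact (convexHull_nonempty_iff).2 hV

theorem IsPolytope.finite_extremePoints (hC : IsPolytope C) : (C.extremePoints ℝ).Finite := by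
  obtain ⟨V, -, rfl⟩ := hC
  exact V.finite_toSet.subset extremePoints_convexHull_subset

theorem IsPolytope.convexHull_extremePoints (hC : IsPolytope C) :
    convexHull ℝ (C.extremePoints ℝ) = C := by
  rw [← (hC.finite_extremePoints.isClosed_convexHull ℝ).closure_eq]
  exact closure_convexHull_extremePoints hC.isCompact hC.convex

theorem IsPolytope.exists_isProperSupport (hC : IsPolytope C) {x : E} (hx : x ∈ C) :
    ∃ S, IsProperSupport C x S := by
  classical
  rw [← hC.convexHull_extremePoints, ← hC.finite_extremePoints.coe_toFinset,
    Finset.mem_convexHull'] at hx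
  obtain ⟨a, ha, hsum, hx⟩ := hx
  refine ⟨hC.finite_extremePoints.toFinset.filter (fun v => a v ≠ 0), ?_, a, ?_, ?_, ?_⟩
  · intro v hv
    simpa using (Finset.mem_filter.1 (Finset.mem_coe.1 hv)).1
  · intro v hv
    obtain ⟨h1, h2⟩ := Finset.mem_filter.1 hv
    exact lt_of_le_of_ne (ha v h1) h2.symm
  · rw [Finset.sum_filter_ne_zero, hsum]
  · rw [← hx, Finset.sum_filter_of_ne]
    intro v _ h h0
    exact h (by rw [h0, zero_smul])

/-- A linear functional attains its minimum over a polytope at a vertex. -/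
theorem IsPolytope.exists_extremePoint_isMinOn (hC : IsPolytope C) (ℓ : E →L[ℝ] ℝ) :
    ∃ v ∈ C.extremePoints ℝ, IsMinOn (fun z => ℓ z) C v := by
  have hne : (C.extremePoints ℝ).Nonempty := hC.isCompact.extremePoints_nonempty hC.nonempty
  obtain ⟨v, hv, hmin⟩ := hC.finite_extremePoints.exists_minimalFor (fun z => ℓ z) _ hne
  refine ⟨v, hv, fun z hz => ?_⟩
  have hsub : C.extremePoints ℝ ⊆ {z | ℓ v ≤ ℓ z} := fun u hu => by
    rcases le_total (ℓ v) (ℓ u) with h | h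
    · exact h
    · exact hmin hu h
  have hcx : Convex ℝ {z | ℓ v ≤ ℓ z} := convex_halfSpace_ge ℓ.isLinear _
  rw [← hC.convexHull_extremePoints] at hz
  exact convexHull_min hsub hcx hz

end Polytope

theorem IsProperSupport.nonempty {C : Set E} {x : E} {S : Finset E} (h : IsProperSupport C x S) :
    S.Nonempty := by
  obtain ⟨-, a, -, h1, -⟩ := h
  by_contra hS
  rw [Finset.not_nonempty_iff_eq_empty] at hS
  simp [hS] at h1

/-! ### The support gap and the strong Wolfe gap -/

section Gap

variable {C : Set E} {f : E → ℝ} {x : E} {S : Finset E}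

theorem bddAbove_supportGap (hC : IsCompact C) (f : E → ℝ) (x : E) (S : Finset E) :
    BddAbove {a : ℝ | ∃ y ∈ S, ∃ z ∈ C, a = fderiv ℝ f x (y - z)} := by
  have hK : IsCompact ((fun p : E × E => fderiv ℝ f x (p.1 - p.2)) '' ((S : Set E) ×ˢ C)) :=
    (S.finite_toSet.isCompact.prod hC).image (by fun_prop)
  refine hK.bddAbove.mono ?_
  rintro a ⟨y, hy, z, hz, rfl⟩
  exact ⟨(y, z), ⟨hy, hz⟩, rfl⟩

theorem le_supportGap (hC : IsCompact C) {y z : E} (hy : y ∈ S) (hz : z ∈ C) :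
    fderiv ℝ f x (y - z) ≤ supportGap C f x S :=
  le_csSup (bddAbove_supportGap hC f x S) ⟨y, hy, z, hz, rfl⟩

theorem IsProperSupport.supportGap_nonneg (hC : IsCompact C) (h : IsProperSupport C x S) :
    0 ≤ supportGap C f x S := by
  obtain ⟨y, hy⟩ := h.nonempty
  simpa using le_supportGap (f := f) (x := x) hC hy (extremePoints_subset (h.1 hy))

/-- The two oracle answers maximize independently, which lets the gap be split at `x` into a
Frank-Wolfe part and an away part. -/
theorem supportGap_eq {s v : E} (hs : s ∈ S)
    (hsmax : IsMaxOn (fun z => fderiv ℝ f x z) (S : Set E) s) (hv : v ∈ C)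
    (hvmin : IsMinOn (fun z => fderiv ℝ f x z) C v) :
    supportGap C f x S = fderiv ℝ f x (s - v) := by
  refine IsGreatest.csSup_eq ⟨⟨s, hs, v, hv, rfl⟩, ?_⟩
  rintro a ⟨y, hy, z, hz, rfl⟩
  have h1 : fderiv ℝ f x y ≤ fderiv ℝ f x s := hsmax hy
  have h2 : fderiv ℝ f x v ≤ fderiv ℝ f x z := hvmin hz
  rw [map_sub, map_sub]
  linarith

/-- `x - z` is an average of the vectors `v - z` with `v ∈ S`. Combined with convexity this makes
the gap an upper bound for `f x - f*`. -/
theorem IsProperSupport.fderiv_sub_le (hC : IsCompact C) (h : IsProperSupport C x S) {z : E}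
    (hz : z ∈ C) : fderiv ℝ f x (x - z) ≤ supportGap C f x S := by
  obtain ⟨-, a, hpos, hsum, hx⟩ := h
  have hxz : x - z = ∑ v ∈ S, a v • (v - z) := by
    simp only [smul_sub, Finset.sum_sub_distrib, ← Finset.sum_smul, hsum, hx, one_smul]
  calc fderiv ℝ f x (x - z) = ∑ v ∈ S, a v * fderiv ℝ f x (v - z) := by
        conv_lhs => rw [hxz]
        rw [map_sum]
        exact Finset.sum_congr rfl fun v _ => by rw [map_smul, smul_eq_mul]
    _ ≤ ∑ v ∈ S, a v * supportGap C f x S :=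
        Finset.sum_le_sum fun v hv =>
          mul_le_mul_of_nonneg_left (le_supportGap hC hv hz) (hpos v hv).le
    _ = supportGap C f x S := by rw [← Finset.sum_mul, hsum, one_mul]

theorem strongWolfeGap_le (hC : IsCompact C) (h : IsProperSupport C x S) :
    strongWolfeGap C f x ≤ supportGap C f x S :=
  csInf_le ⟨0, by rintro a ⟨S', hS', rfl⟩; exact hS'.supportGap_nonneg hC⟩ ⟨S, h, rfl⟩

theorem le_strongWolfeGap (hC : IsPolytope C) (hx : x ∈ C) {b : ℝ}
    (h : ∀ S, IsProperSupport C x S → b ≤ supportGap C f x S) : b ≤ strongWolfeGap C f x := by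
  obtain ⟨S, hS⟩ := hC.exists_isProperSupport hx
  refine le_csInf ⟨_, S, hS, rfl⟩ ?_
  rintro a ⟨S', hS', rfl⟩
  exact h S' hS'

theorem strongWolfeGap_nonneg (hC : IsPolytope C) (hx : x ∈ C) : 0 ≤ strongWolfeGap C f x :=
  le_strongWolfeGap hC hx fun _ hS => hS.supportGap_nonneg hC.isCompact

end Gap

/-! ### Scaling of polytopes -/

/-- A polytope satisfies a scaling inequality. -/
theorem IsPolytope.exists_scaling {C : Set E} (hC : IsPolytope C) :
    ∃ δ : ℝ, 0 < δ ∧ Scaling C δ := by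
  classical
  set V := hC.finite_extremePoints.toFinset with hV
  obtain ⟨κ, hκ, hbd⟩ := exists_conic_weights_le (fun p : E × E => p.1 - p.2) (V ×ˢ V)
  refine ⟨κ⁻¹, inv_pos.2 hκ, fun f _ _ x hx y hy => ?_⟩
  refine le_strongWolfeGap hC hx.1 fun S hS => ?_
  have hne : x ≠ y := fun h => hx.2 (h ▸ hy)
  have hnorm : 0 < ‖x - y‖ := norm_pos_iff.2 (sub_ne_zero.2 hne)
  obtain ⟨hSV, a, hapos, hasum, hax⟩ := id hS
  have hyC : y ∈ convexHull ℝ (V : Set E) := by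
    rw [hV, hC.finite_extremePoints.coe_toFinset, hC.convexHull_extremePoints]
    exact hy.1
  rw [Finset.mem_convexHull'] at hyC
  obtain ⟨b, hb, hbsum, hby⟩ := hyC
  have hSV' : S ⊆ V := fun u hu => by simpa [hV] using hSV hu
  -- The product weights write `x - y` through the pairs of `S ×ˢ V`. The reduction keeps only such
  -- pairs, so each of them costs at most the gap of `S`, while `κ` depends on `V` alone.
  obtain ⟨t, ht, l, hl, hlsum, hlle⟩ := hbd (S ×ˢ V) (Finset.product_subset_product_left hSV')
    (fun p => a p.1 * b p.2) (by
      intro p hp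
      obtain ⟨h1, h2⟩ := Finset.mem_product.1 hp
      exact mul_nonneg (hapos _ h1).le (hb _ h2))
  have hxy : ∑ p ∈ S ×ˢ V, (a p.1 * b p.2) • (p.1 - p.2) = x - y := by
    rw [Finset.sum_product]
    have h1 : ∀ u ∈ S, ∑ v ∈ V, (a u * b v) • (u - v) = a u • (u - y) := by
      intro u _
      simp only [mul_smul, smul_sub, Finset.sum_sub_distrib, ← Finset.smul_sum, ← Finset.sum_smul,
        hbsum, hby, one_smul]
    rw [Finset.sum_congr rfl h1]
    simp only [smul_sub, Finset.sum_sub_distrib, ← Finset.sum_smul, hasum, hax, one_smul]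
  rw [hxy] at hlsum hlle
  have hg0 : 0 ≤ supportGap C f x S := hS.supportGap_nonneg hC.isCompact
  have key : fderiv ℝ f x (x - y) ≤ κ * ‖x - y‖ * supportGap C f x S := by
    calc fderiv ℝ f x (x - y) = ∑ p ∈ t, l p * fderiv ℝ f x (p.1 - p.2) := by
          rw [← hlsum, map_sum]
          exact Finset.sum_congr rfl fun v _ => by rw [map_smul, smul_eq_mul]
      _ ≤ ∑ p ∈ t, l p * supportGap C f x S := by
          refine Finset.sum_le_sum fun p hp => mul_le_mul_of_nonneg_left ?_ (hl p hp)
          obtain ⟨h1, h2⟩ := Finset.mem_product.1 (ht hp)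
          refine le_supportGap hC.isCompact h1 (extremePoints_subset (𝕜 := ℝ) ?_)
          simpa [hV] using h2
      _ = (∑ p ∈ t, l p) * supportGap C f x S := by rw [Finset.sum_mul]
      _ ≤ κ * ‖x - y‖ * supportGap C f x S := mul_le_mul_of_nonneg_right hlle hg0
  rw [map_smul, smul_eq_mul]
  calc κ⁻¹ * (‖x - y‖⁻¹ * fderiv ℝ f x (x - y))
      ≤ κ⁻¹ * (‖x - y‖⁻¹ * (κ * ‖x - y‖ * supportGap C f x S)) := by gcongr
    _ = supportGap C f x S := by field_simp

variable {C : Set E} {f : E → ℝ}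

/-! ### Convexity, curvature and line search -/

section Objective

theorem convexOn_comp_line (hf : ConvexOn ℝ univ f) (x d : E) :
    ConvexOn ℝ univ (fun t : ℝ => f (x + t • d)) := by
  refine ⟨convex_univ, fun a _ b _ p q hp hq hpq => ?_⟩
  have h := hf.2 (mem_univ (x + a • d)) (mem_univ (x + b • d)) hp hq hpq
  have hx : p • (x + a • d) + q • (x + b • d) = (p + q) • x + (p • a + q • b) • d := by
    simp only [smul_eq_mul]
    module
  rwa [hx, hpq, one_smul] at h

/-- The linear lower bound of a differentiable convex function. -/
theorem fderiv_sub_le_of_convexOn (hf : ConvexOn ℝ univ f) (hd : Differentiable ℝ f) (x y : E) :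
    f x - f y ≤ fderiv ℝ f x (x - y) := by
  have hder : HasDerivAt (fun t : ℝ => f (x + t • (y - x))) (fderiv ℝ f x (y - x)) 0 := by
    have h1 : HasFDerivAt f (fderiv ℝ f x) (x + (0 : ℝ) • (y - x)) := by
      simpa using (hd x).hasFDerivAt
    refine h1.comp_hasDerivAt (0 : ℝ) ?_
    simpa using ((hasDerivAt_id (0 : ℝ)).smul_const (y - x)).const_add x
  have h := (convexOn_comp_line hf x (y - x)).le_slope_of_hasDerivAt (mem_univ 0) (mem_univ 1)
    one_pos hder
  simp only [slope_def_field, one_smul, zero_smul, add_zero, sub_zero, div_one,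
    add_sub_cancel] at h
  rw [← neg_sub y x, map_neg]
  linarith

theorem minimizers_nonempty (hC : IsCompact C) (hne : C.Nonempty) (hd : Differentiable ℝ f) :
    (minimizers C f).Nonempty := by
  obtain ⟨x, hx, hmin⟩ := hC.exists_isMinOn hne hd.continuous.continuousOn
  exact ⟨x, hx, hmin⟩

theorem optValue_eq {E : Type*} {C : Set E} {f : E → ℝ} {y : E} (hy : y ∈ minimizers C f) : optValue C f = f y :=
  IsLeast.csInf_eq ⟨⟨y, hy.1, rfl⟩, by rintro _ ⟨z, hz, rfl⟩; exact hy.2 hz⟩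

theorem optValue_le (hC : IsCompact C) (hd : Differentiable ℝ f) {x : E} (hx : x ∈ C) :
    optValue C f ≤ f x := by
  obtain ⟨y, hy⟩ := minimizers_nonempty hC ⟨x, hx⟩ hd
  rw [optValue_eq hy]
  exact hy.2 hx

theorem isCompact_minimizers (hC : IsCompact C) (hd : Differentiable ℝ f) :
    IsCompact (minimizers C f) := by
  refine hC.of_isClosed_subset ?_ fun x hx => hx.1
  rcases (minimizers C f).eq_empty_or_nonempty with h | ⟨y, hy⟩
  · rw [h]
    exact isClosed_empty
  have : minimizers C f = C ∩ {x | f x ≤ f y} := by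
    ext x
    refine ⟨fun hx => ⟨hx.1, hx.2 hy.1⟩, fun hx => ⟨hx.1, fun z hz => ?_⟩⟩
    have h : f y ≤ f z := hy.2 hz
    exact le_trans hx.2 h
  rw [this]
  exact hC.isClosed.inter (isClosed_le hd.continuous continuous_const)

theorem IsProperSupport.sub_optValue_le (hC : IsCompact C) (hf : IsSmoothConvex C f) {x : E}
    {S : Finset E} (hx : x ∈ C) (h : IsProperSupport C x S) :
    f x - optValue C f ≤ supportGap C f x S := by
  obtain ⟨y, hy⟩ := minimizers_nonempty hC ⟨x, hx⟩ hf.differentiable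
  rw [optValue_eq hy]
  exact (fderiv_sub_le_of_convexOn hf.convex hf.differentiable x y).trans
    (h.fderiv_sub_le hC hy.1)

/-- `K` bounds the away curvature. -/
def CurvatureLE (C : Set E) (f : E → ℝ) (K : ℝ) : Prop :=
  ∀ x ∈ C, ∀ s ∈ C, ∀ v ∈ C, ∀ η ∈ Icc (0 : ℝ) 1,
    f (x + η • (s - v)) ≤ f x + η * fderiv ℝ f x (s - v) + η ^ 2 * K / 2

/-- The freedom to enlarge `K` is what later replaces the burn-in assumption. -/
theorem CurvatureLE.mono {K K' : ℝ} (h : CurvatureLE C f K) (hK : K ≤ K') :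
    CurvatureLE C f K' := by
  intro x hx s hs v hv η hη
  have h1 := h x hx s hs v hv η hη
  have h2 := mul_le_mul_of_nonneg_left hK (sq_nonneg η)
  linarith

/-- The mean value inequality for `f` minus its linearization at `x` bounds the error by `L ‖η • (s
- v)‖ ^ 2`, and the factor `η ^ 2` cancels. Boundedness is needed for the `sSup` in `awayCurvature`
to be a true supremum. -/
theorem bddAbove_awayCurvature (hcx : Convex ℝ C) (hC : IsCompact C) (hf : IsSmoothConvex C f) :
    BddAbove {a : ℝ | ∃ x ∈ C, ∃ s ∈ C, ∃ v ∈ C, ∃ η ∈ Ioc (0 : ℝ) 1,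
      a = 2 / η ^ 2 * (f (x + η • (s - v)) - f x - η * fderiv ℝ f x (s - v))} := by
  obtain ⟨L, hL⟩ := hf.smooth
  have hcx' : Convex ℝ (C + (C - C)) := hcx.add (hcx.sub hcx)
  refine ⟨2 * (L * Metric.diam C ^ 2), ?_⟩
  rintro a ⟨x, hx, s, hs, v, hv, η, hη, rfl⟩
  have h1 : x ∈ C + (C - C) := ⟨x, hx, 0, ⟨x, hx, x, hx, sub_self x⟩, add_zero x⟩
  have h2 : x + η • (s - v) ∈ C + (C - C) := by
    -- `η(s - v) = (ηs + (1 - η)v) - v` is a difference of two points of `C`.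
    refine ⟨x, hx, η • (s - v), ⟨η • s + (1 - η) • v,
      hcx hs hv hη.1.le (by linarith [hη.2]) (by ring), v, hv, ?_⟩, rfl⟩
    module
  have hseg : segment ℝ x (x + η • (s - v)) ⊆ C + (C - C) := hcx'.segment_subset h1 h2
  have hmv := (convex_segment x (x + η • (s - v))).norm_image_sub_le_of_norm_hasFDerivWithin_le'
    (f := f) (f' := fderiv ℝ f) (φ := fderiv ℝ f x) (C := L * ‖η • (s - v)‖)
    (fun z _ => (hf.differentiable z).hasFDerivAt.hasFDerivWithinAt)
    (fun z hz => by
      have h3 := hL.norm_sub_le (hseg hz) h1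
      refine h3.trans (mul_le_mul_of_nonneg_left ?_ L.2)
      have := norm_sub_le_of_mem_segment hz
      simpa using this)
    (left_mem_segment ℝ _ _) (right_mem_segment ℝ _ _)
  rw [add_sub_cancel_left, map_smul, smul_eq_mul, Real.norm_eq_abs, norm_smul, Real.norm_eq_abs,
    abs_of_pos hη.1] at hmv
  have hsv : ‖s - v‖ ≤ Metric.diam C := by
    rw [← dist_eq_norm]
    exact Metric.dist_le_diam_of_mem hC.isBounded hs hv
  calc 2 / η ^ 2 * (f (x + η • (s - v)) - f x - η * fderiv ℝ f x (s - v))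
      ≤ 2 / η ^ 2 * (L * (η * ‖s - v‖) * (η * ‖s - v‖)) :=
        mul_le_mul_of_nonneg_left ((le_abs_self _).trans hmv) (by positivity)
    _ = 2 * (L * ‖s - v‖ ^ 2) := by
        have := hη.1.ne'
        field_simp
    _ ≤ 2 * (L * Metric.diam C ^ 2) := by gcongr

theorem curvatureLE_awayCurvature (hcx : Convex ℝ C) (hC : IsCompact C)
    (hf : IsSmoothConvex C f) : CurvatureLE C f (awayCurvature C f) := by
  intro x hx s hs v hv η hη
  rcases eq_or_lt_of_le hη.1 with h | h
  · simp [← h]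
  have h1 := le_csSup (bddAbove_awayCurvature hcx hC hf) ⟨x, hx, s, hs, v, hv, η, ⟨h, hη.2⟩, rfl⟩
  change _ ≤ awayCurvature C f at h1
  have h2 := mul_le_mul_of_nonneg_left h1 (show 0 ≤ η ^ 2 / 2 by positivity)
  rw [← mul_assoc, show η ^ 2 / 2 * (2 / η ^ 2) = 1 by field_simp, one_mul] at h2
  linarith

theorem awayCurvature_nonneg (hcx : Convex ℝ C) (hC : IsCompact C) (hne : C.Nonempty)
    (hf : IsSmoothConvex C f) : 0 ≤ awayCurvature C f := by
  obtain ⟨x, hx⟩ := hne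
  exact le_csSup (bddAbove_awayCurvature hcx hC hf)
    ⟨x, hx, x, hx, x, hx, 1, ⟨one_pos, le_rfl⟩, by simp⟩

theorem exists_fderiv_sub_le (hC : IsCompact C) (hf : IsSmoothConvex C f) :
    ∃ B : ℝ, 0 ≤ B ∧ ∀ x ∈ C, ∀ y ∈ C, ∀ z ∈ C, fderiv ℝ f x (y - z) ≤ B := by
  obtain ⟨L, hL⟩ := hf.smooth
  rcases C.eq_empty_or_nonempty with rfl | ⟨x₀, hx₀⟩
  · exact ⟨0, le_rfl, by simp⟩
  have hmem : ∀ x ∈ C, x ∈ C + (C - C) := fun x hx =>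
    ⟨x, hx, 0, ⟨x, hx, x, hx, sub_self x⟩, add_zero x⟩
  have hD : ∀ x ∈ C, ∀ y ∈ C, ‖x - y‖ ≤ Metric.diam C := fun x hx y hy => by
    rw [← dist_eq_norm]
    exact Metric.dist_le_diam_of_mem hC.isBounded hx hy
  have hD0 : 0 ≤ Metric.diam C := Metric.diam_nonneg
  refine ⟨(‖fderiv ℝ f x₀‖ + L * Metric.diam C) * Metric.diam C, by positivity,
    fun x hx y hy z hz => ?_⟩
  have h1 : ‖fderiv ℝ f x‖ ≤ ‖fderiv ℝ f x₀‖ + L * Metric.diam C := by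
    have h2 := hL.norm_sub_le (hmem x hx) (hmem x₀ hx₀)
    have h3 := mul_le_mul_of_nonneg_left (hD x hx x₀ hx₀) L.2
    have h4 := norm_le_norm_add_norm_sub' (fderiv ℝ f x) (fderiv ℝ f x₀)
    exact h4.trans (add_le_add le_rfl (h2.trans h3))
  calc fderiv ℝ f x (y - z) ≤ ‖fderiv ℝ f x (y - z)‖ := le_abs_self _
    _ ≤ ‖fderiv ℝ f x‖ * ‖y - z‖ := (fderiv ℝ f x).le_opNorm _
    _ ≤ _ := mul_le_mul h1 (hD y hy z hz) (norm_nonneg _) (by positivity)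

/-- Progress of an exact line search that is not blocked by its step bound. -/
theorem IsLineSearch.progress (hf : ConvexOn ℝ univ f) {K Γ : ℝ} (hcurv : CurvatureLE C f K)
    (hK : 0 < K) (hΓ : 0 ≤ Γ) (hΓK : Γ ≤ K) {x s v : E} (hx : x ∈ C) (hs : s ∈ C) (hv : v ∈ C)
    (hder : fderiv ℝ f x (s - v) ≤ -Γ) {ηmax η : ℝ} (h : IsLineSearch f x (s - v) ηmax η)
    (hη : 1 ≤ ηmax ∨ η < ηmax) :
    Γ ^ 2 / (2 * K) ≤ f x - f (x + η • (s - v)) := by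
  -- `Γ / K` minimizes the quadratic upper bound `-ηΓ + η²K/2`, and `Γ ≤ K` makes it an admissible
  -- step in the curvature inequality.
  have hη₀ : Γ / K ∈ Icc (0 : ℝ) 1 := ⟨by positivity, (div_le_one hK).2 hΓK⟩
  have h1 := hcurv x hx s hs v hv _ hη₀
  have h2 := mul_le_mul_of_nonneg_left hder hη₀.1
  have h3 : Γ / K * -Γ + (Γ / K) ^ 2 * K / 2 = -(Γ ^ 2 / (2 * K)) := by field_simp; ring
  suffices hle : f (x + η • (s - v)) ≤ f (x + (Γ / K) • (s - v)) by linarith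
  rcases le_or_gt (Γ / K) ηmax with hle | hgt
  · exact h.2 ⟨hη₀.1, hle⟩
  have hlt : η < ηmax := hη.resolve_left fun h' => by linarith [hη₀.2]
  -- Here `η < ηmax < Γ / K`. If the trial step beyond the bound were better than `η`, convexity
  -- would make `ηmax` strictly better than `η` too, contradicting the line search.
  by_contra! hcon
  have hmem : ηmax ∈ openSegment ℝ η (Γ / K) := by
    rw [openSegment_eq_Ioo (hlt.trans hgt)]
    exact ⟨hlt, hgt⟩
  have h4 := (convexOn_comp_line hf x (s - v)).lt_left_of_right_lt (mem_univ _) (mem_univ _) hmem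
    (lt_of_lt_of_le hcon (h.2 ⟨h.1.1.trans hlt.le, le_rfl⟩))
  exact absurd (h.2 ⟨h.1.1.trans hlt.le, le_rfl⟩) (not_le.2 h4)

end Objective

/-! ### Weights and active sets -/

section Representation

theorem point_eq (α : E →₀ ℝ) : point α = Finsupp.linearCombination ℝ id α := rfl

theorem sum_weights_eq {E : Type*} (α : E →₀ ℝ) :
    (α.sum fun _ a => a) = Finsupp.linearCombination ℝ (fun _ => (1 : ℝ)) α := by
  simp [Finsupp.linearCombination_apply]

theorem point_toward (α : E →₀ ℝ) (v : E) (η : ℝ) :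
    point ((1 - η) • α + Finsupp.single v η) = point α + η • (v - point α) := by
  simp only [point_eq, map_add, map_smul, Finsupp.linearCombination_single, id]
  module

theorem point_away (α : E →₀ ℝ) (s : E) (η : ℝ) :
    point ((1 + η) • α - Finsupp.single s η) = point α + η • (point α - s) := by
  simp only [point_eq, map_sub, map_smul, Finsupp.linearCombination_single, id]
  module

variable {α : E →₀ ℝ}

theorem IsActiveRep.isProperSupport (h : IsActiveRep C α) :
    IsProperSupport C (point α) α.support :=
  ⟨fun v hv => h.extreme v hv, α, h.pos, h.sum_eq_one, rfl⟩

theorem IsActiveRep.nonneg (h : IsActiveRep C α) (v : E) : 0 ≤ α v := by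
  by_cases hv : v ∈ α.support
  · exact (h.pos v hv).le
  · rw [Finsupp.notMem_support_iff.1 hv]

theorem IsActiveRep.point_mem (hC : Convex ℝ C) (h : IsActiveRep C α) : point α ∈ C :=
  hC.sum_mem (fun v hv => (h.pos v hv).le) h.sum_eq_one
    fun v hv => extremePoints_subset (h.extreme v hv)

theorem IsActiveRep.le_one (h : IsActiveRep C α) {s : E} (hs : s ∈ α.support) : α s ≤ 1 := by
  rw [← h.sum_eq_one]
  exact Finset.single_le_sum (f := fun v => α v) (fun v _ => h.nonneg v) hs

/-- Used to rule out the degenerate away step, in which the direction is zero and the step bound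
divides by zero. -/
theorem IsActiveRep.point_eq_of_eq_one (h : IsActiveRep C α) {s : E} (hs : s ∈ α.support)
    (h1 : α s = 1) : point α = s := by
  classical
  have hz : ∀ v ∈ α.support.erase s, α v = 0 := by
    have hsum : ∑ v ∈ α.support.erase s, α v = 0 := by
      have h2 : ∑ v ∈ α.support, α v = 1 := h.sum_eq_one
      rw [← Finset.add_sum_erase _ _ hs, h1] at h2
      linarith
    exact (Finset.sum_eq_zero_iff_of_nonneg fun v _ => h.nonneg v).1 hsum
  change ∑ v ∈ α.support, α v • v = s
  rw [← Finset.add_sum_erase _ _ hs, h1, one_smul, Finset.sum_eq_zero, add_zero]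
  intro v hv
  rw [hz v hv, zero_smul]

theorem IsActiveRep.card_le (hC : IsPolytope C) (h : IsActiveRep C α) :
    α.support.card ≤ (C.extremePoints ℝ).ncard := by
  rw [← Set.ncard_coe_finset]
  exact Set.ncard_le_ncard (fun v hv => h.extreme v hv) hC.finite_extremePoints

theorem IsActiveRep.toward (h : IsActiveRep C α) {v : E} (hv : v ∈ C.extremePoints ℝ) {η : ℝ}
    (hη : η ∈ Icc (0 : ℝ) 1) : IsActiveRep C ((1 - η) • α + Finsupp.single v η) := by
  classical
  have hval : ∀ u, 0 ≤ ((1 - η) • α + Finsupp.single v η) u := by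
    intro u
    rw [Finsupp.add_apply, Finsupp.smul_apply, smul_eq_mul, Finsupp.single_apply]
    have := mul_nonneg (sub_nonneg.2 hη.2) (h.nonneg u)
    split_ifs
    · linarith [hη.1]
    · linarith
  refine ⟨fun u hu => ?_, fun u hu => ?_, ?_⟩
  · rcases Finset.mem_union.1 (Finsupp.support_add hu) with hu | hu
    · exact h.extreme u (Finsupp.support_smul hu)
    · rw [Finset.mem_singleton.1 (Finsupp.support_single_subset hu)]
      exact hv
  · exact lt_of_le_of_ne (hval u) (Finsupp.mem_support_iff.1 hu).symm
  · have := h.sum_eq_one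
    rw [sum_weights_eq] at this ⊢
    rw [map_add, map_smul, this, Finsupp.linearCombination_single]
    simp

theorem IsActiveRep.away (h : IsActiveRep C α) {s : E} (hs : s ∈ α.support) {η : ℝ}
    (hη : η ∈ Icc (0 : ℝ) (α s / (1 - α s))) :
    IsActiveRep C ((1 + η) • α - Finsupp.single s η) := by
  classical
  have hval : ∀ u, 0 ≤ ((1 + η) • α - Finsupp.single s η) u := by
    intro u
    rw [Finsupp.sub_apply, Finsupp.smul_apply, smul_eq_mul, Finsupp.single_apply]
    have hu := mul_nonneg (add_nonneg zero_le_one hη.1) (h.nonneg u)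
    split_ifs with hus
    · subst hus
      rcases eq_or_lt_of_le (h.le_one hs) with h1 | h1
      -- For weight one the step bound is `1 / 0 = 0`, so `η = 0`.
      · have h2 := hη.2
        rw [h1, sub_self, div_zero] at h2
        linarith [hη.1]
      · have h2 := (le_div_iff₀ (sub_pos.2 h1)).1 hη.2
        linarith
    · linarith
  refine ⟨fun u hu => ?_, fun u hu => ?_, ?_⟩
  · rcases Finset.mem_union.1 (Finsupp.support_sub hu) with hu | hu
    · exact h.extreme u (Finsupp.support_smul hu)
    · rw [Finset.mem_singleton.1 (Finsupp.support_single_subset hu)]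
      exact h.extreme s hs
  · exact lt_of_le_of_ne (hval u) (Finsupp.mem_support_iff.1 hu).symm
  · have := h.sum_eq_one
    rw [sum_weights_eq] at this ⊢
    rw [map_sub, map_smul, this, Finsupp.linearCombination_single]
    simp

theorem card_support_toward_le {E : Type*} (α : E →₀ ℝ) (v : E) (η : ℝ) :
    ((1 - η) • α + Finsupp.single v η).support.card ≤ α.support.card + 1 := by
  classical
  refine (Finset.card_le_card Finsupp.support_add).trans ((Finset.card_union_le _ _).trans ?_)
  refine add_le_add (Finset.card_le_card Finsupp.support_smul) ?_
  exact (Finset.card_le_card Finsupp.support_single_subset).trans (Finset.card_singleton v).le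

theorem support_away_subset {E : Type*} (α : E →₀ ℝ) {s : E} (hs : s ∈ α.support) (η : ℝ) :
    ((1 + η) • α - Finsupp.single s η).support ⊆ α.support := by
  classical
  refine Finsupp.support_sub.trans (Finset.union_subset Finsupp.support_smul ?_)
  exact Finsupp.support_single_subset.trans (Finset.singleton_subset_iff.2 hs)

/-- At the maximal step the new weight `(1 + η) α s - η` is zero, and an away step brings in no
other vertex. -/
theorem card_support_away_lt {E : Type*} (α : E →₀ ℝ) {s : E} (hs : s ∈ α.support)
    (h1 : α s ≠ 1) : ((1 + α s / (1 - α s)) • α -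
      Finsupp.single s (α s / (1 - α s))).support.card < α.support.card := by
  refine Finset.card_lt_card ⟨support_away_subset α hs _, fun hsub => ?_⟩
  refine Finsupp.mem_support_iff.1 (hsub hs) ?_
  have : 1 - α s ≠ 0 := sub_ne_zero.2 (Ne.symm h1)
  rw [Finsupp.sub_apply, Finsupp.smul_apply, smul_eq_mul, Finsupp.single_eq_same]
  field_simp
  ring

theorem IsActiveRep.gap_nonneg (hC : IsPolytope C) (h : IsActiveRep C α) : 0 ≤ gap C f α :=
  h.isProperSupport.supportGap_nonneg hC.isCompact

theorem IsActiveRep.strongWolfeGap_le_gap (hC : IsPolytope C) (h : IsActiveRep C α) :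
    strongWolfeGap C f (point α) ≤ gap C f α :=
  strongWolfeGap_le hC.isCompact h.isProperSupport

theorem IsActiveRep.sub_optValue_le_gap (hC : IsPolytope C) (hf : IsSmoothConvex C f)
    (h : IsActiveRep C α) : f (point α) - optValue C f ≤ gap C f α :=
  h.isProperSupport.sub_optValue_le hC.isCompact hf (h.point_mem hC.convex)

end Representation

/-! ### Progress of a single call -/

section Steps

variable {γ W : ℝ} {α β : E →₀ ℝ}

theorem FracStep.isActiveRep (hα : IsActiveRep C α) (h : FracStep C f γ W α β) :
    IsActiveRep C β := by
  obtain ⟨-, v, s, η, hv, hs, ⟨-, hη, rfl⟩ | ⟨-, hη, rfl⟩⟩ := h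
  · exact hα.toward hv.1 hη.1
  · exact hα.away hs.1 hη.1

theorem FracRun.isActiveRep (hα : IsActiveRep C α) {n : ℕ} (h : FracRun C f γ W α n β) :
    IsActiveRep C β := by
  induction h with
  | refl => exact hα
  | step _ hs ih => exact hs.isActiveRep ih

theorem FracStep.apply_point_le (hα : IsActiveRep C α) (h : FracStep C f γ W α β) :
    f (point β) ≤ f (point α) := by
  obtain ⟨-, v, s, η, hv, hs, ⟨-, hη, rfl⟩ | ⟨-, hη, rfl⟩⟩ := h
  · rw [point_toward]
    simpa using hη.2 (show (0 : ℝ) ∈ Icc (0 : ℝ) 1 by simp)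
  · rw [point_away]
    simpa using hη.2 (show (0 : ℝ) ∈ Icc (0 : ℝ) (α s / (1 - α s)) from ⟨le_rfl,
      div_nonneg (hα.nonneg s) (sub_nonneg.2 (hα.le_one hs.1))⟩)

theorem FracRun.apply_point_le (hα : IsActiveRep C α) {n : ℕ} (h : FracRun C f γ W α n β) :
    f (point β) ≤ f (point α) := by
  induction h with
  | refl => exact le_rfl
  | step hr hs ih => exact (hs.apply_point_le (hr.isActiveRep hα)).trans ih

/-- The decrease of the objective pays for an iteration and for the growth of the active set. -/
theorem FracStep.progress (hC : IsPolytope C) (hf : IsSmoothConvex C f) {K : ℝ}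
    (hcurv : CurvatureLE C f K) (hK : 0 < K) (hW : 0 ≤ W) (hWK : Real.exp (-γ) * W / 2 ≤ K)
    (hα : IsActiveRep C α) (h : FracStep C f γ W α β) :
    W ^ 2 * (1 + β.support.card - α.support.card) ≤
      16 * K * Real.exp (2 * γ) * (f (point α) - f (point β)) := by
  have hmono := h.apply_point_le hα
  set Γ := Real.exp (-γ) * W / 2 with hΓ
  have hΓ0 : 0 ≤ Γ := by positivity
  have hx : point α ∈ C := hα.point_mem hC.convex
  have hsq : W ^ 2 = 4 * Real.exp (2 * γ) * Γ ^ 2 := by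
    have h1 : Real.exp (2 * γ) * (Real.exp (-γ) * Real.exp (-γ)) = 1 := by
      rw [← Real.exp_add, ← Real.exp_add, ← Real.exp_zero]
      congr 1
      ring
    rw [hΓ]
    linear_combination (-W ^ 2) * h1
  have hE : 0 < Real.exp (2 * γ) := Real.exp_pos _
  have hrhs : 0 ≤ 16 * K * Real.exp (2 * γ) * (f (point α) - f (point β)) :=
    mul_nonneg (by positivity) (sub_nonneg.2 hmono)
  -- A progress step counts at most twice: once as an iteration, once for an entering vertex. The
  -- constant comes from `2W² = 8e^{2γ}Γ² = 16Ke^{2γ} · Γ²/(2K)`.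
  have good : (β.support.card : ℝ) ≤ α.support.card + 1 →
      Γ ^ 2 / (2 * K) ≤ f (point α) - f (point β) →
      W ^ 2 * (1 + β.support.card - α.support.card) ≤
        16 * K * Real.exp (2 * γ) * (f (point α) - f (point β)) := by
    intro hcard hprog
    calc W ^ 2 * (1 + β.support.card - α.support.card) ≤ W ^ 2 * 2 :=
          mul_le_mul_of_nonneg_left (by linarith) (sq_nonneg _)
      _ = 16 * K * Real.exp (2 * γ) * (Γ ^ 2 / (2 * K)) := by
          rw [hsq]
          field_simp
          ring
      _ ≤ _ := mul_le_mul_of_nonneg_left hprog (by positivity)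
  obtain ⟨hgap, v, s, η, hv, hs, ⟨hdir, hη, rfl⟩ | ⟨hdir, hη, rfl⟩⟩ := h
  · refine good (by exact_mod_cast card_support_toward_le α v η) ?_
    rw [point_toward]
    exact hη.progress hf.convex hcurv hK hΓ0 hWK hx (extremePoints_subset hv.1) hx
      (by linarith) (Or.inl le_rfl)
  · have hgap' : gap C f α = fderiv ℝ f (point α) (s - v) :=
      supportGap_eq hs.1 hs.2 (extremePoints_subset hv.1) hv.2
    -- The whole gap exceeds `2Γ` and the Frank-Wolfe part is at most `Γ`, so the away part exceeds
    -- `Γ`.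
    have hder : fderiv ℝ f (point α) (point α - s) < -Γ := by
      rw [hgap', map_sub] at hgap
      rw [map_sub] at hdir ⊢
      have : Real.exp (-γ) * W = 2 * Γ := by rw [hΓ]; ring
      linarith
    have h1 : α s ≠ 1 := by
      intro h1
      rw [← hα.point_eq_of_eq_one hs.1 h1, sub_self, map_zero] at hder
      linarith
    rcases lt_or_eq_of_le hη.1.2 with hlt | heq
    · refine good ?_ ?_
      · have := Finset.card_le_card (support_away_subset α hs.1 η)
        exact_mod_cast this.trans (Nat.le_succ _)
      · rw [point_away]
        exact hη.progress hf.convex hcurv hK hΓ0 hWK hx hx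
          (extremePoints_subset (hα.extreme s hs.1)) hder.le (Or.inr hlt)
    -- Blocked away step: the lost vertex cancels the iteration, so monotonicity of `f` suffices.
    · refine le_trans (mul_nonpos_of_nonneg_of_nonpos (sq_nonneg _) ?_) hrhs
      have h2 := card_support_away_lt α hs.1 h1
      rw [heq]
      have h3 : (((1 + α s / (1 - α s)) • α -
        Finsupp.single s (α s / (1 - α s))).support.card : ℝ) + 1 ≤ α.support.card := by
        exact_mod_cast h2
      linarith

theorem FracRun.progress (hC : IsPolytope C) (hf : IsSmoothConvex C f) {K : ℝ}
    (hcurv : CurvatureLE C f K) (hK : 0 < K) (hW : 0 ≤ W) (hWK : Real.exp (-γ) * W / 2 ≤ K)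
    (hα : IsActiveRep C α) {n : ℕ} (h : FracRun C f γ W α n β) :
    W ^ 2 * (n + β.support.card - α.support.card) ≤
      16 * K * Real.exp (2 * γ) * (f (point α) - f (point β)) := by
  induction h with
  | refl => simp
  | @step n β β' hr hs ih =>
    have h1 := hs.progress hC hf hcurv hK hW hWK (hr.isActiveRep hα)
    have h2 := add_le_add ih h1
    push_cast
    refine le_trans (le_of_eq ?_) (h2.trans (le_of_eq ?_)) <;> ring

/-- The oracles and the line search always have an answer. -/
theorem exists_fracStep (hC : IsPolytope C) (hf : IsSmoothConvex C f) (hα : IsActiveRep C α)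
    (h : Real.exp (-γ) * W < gap C f α) : ∃ β, FracStep C f γ W α β := by
  have line : ∀ (d : E) (m : ℝ), 0 ≤ m → ∃ η, IsLineSearch f (point α) d m η := by
    intro d m hm
    obtain ⟨η, hη, hmin⟩ := (isCompact_Icc (a := (0 : ℝ)) (b := m)).exists_isMinOn
      (nonempty_Icc.2 hm) (f := fun t : ℝ => f (point α + t • d))
      (hf.differentiable.continuous.comp (by fun_prop)).continuousOn
    exact ⟨η, hη, hmin⟩
  obtain ⟨v, hv, hvmin⟩ := hC.exists_extremePoint_isMinOn (fderiv ℝ f (point α))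
  obtain ⟨s, hs, hsmax⟩ := Finset.exists_max_image α.support (fun z => fderiv ℝ f (point α) z)
    hα.isProperSupport.nonempty
  rcases lt_or_ge (Real.exp (-γ) * W / 2) (-(fderiv ℝ f (point α) (v - point α))) with hd | hd
  · obtain ⟨η, hη⟩ := line (v - point α) 1 zero_le_one
    exact ⟨_, h, v, s, η, ⟨hv, hvmin⟩, ⟨hs, hsmax⟩, Or.inl ⟨hd, hη, rfl⟩⟩
  · obtain ⟨η, hη⟩ := line (point α - s) (α s / (1 - α s))
      (div_nonneg (hα.nonneg s) (sub_nonneg.2 (hα.le_one hs)))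
    exact ⟨_, h, v, s, η, ⟨hv, hvmin⟩, ⟨hs, hsmax⟩, Or.inr ⟨hd, hη, rfl⟩⟩

end Steps

/-! ### Error bounds and the primal gap -/

section ErrorBound

/-- The strong Wolfe primal bound. -/
theorem sub_optValue_le_strongWolfeGap_rpow (hC : IsPolytope C) (hf : IsSmoothConvex C f)
    {θ c δ : ℝ} (hθ : θ < 1) (hc : 0 < c) (hδ : 0 < δ) (hH : HEB C f θ c) (hS : Scaling C δ)
    {x : E} (hx : x ∈ C) :
    f x - optValue C f ≤ (c / δ) ^ (1 / (1 - θ)) * strongWolfeGap C f x ^ (1 / (1 - θ)) := by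
  have hw := strongWolfeGap_nonneg (f := f) hC hx
  have hcδ : 0 < c / δ := div_pos hc hδ
  obtain ⟨y, hy, hdist⟩ :=
    (isCompact_minimizers hC.isCompact hf.differentiable).exists_infDist_eq_dist
      (minimizers_nonempty hC.isCompact ⟨x, hx⟩ hf.differentiable) x
  have hopt : optValue C f = f y := optValue_eq hy
  rcases le_or_gt (f x - optValue C f) 0 with hle | hpos
  · exact hle.trans (by positivity)
  have hxm : x ∉ minimizers C f := fun h => by
    rw [optValue_eq h, sub_self] at hpos
    exact lt_irrefl _ hpos
  have hne : x ≠ y := fun h => hxm (h ▸ hy)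
  have hnorm : 0 < ‖x - y‖ := norm_pos_iff.2 (sub_ne_zero.2 hne)
  have h1 := hS f hf.convex hf.differentiable x ⟨hx, hxm⟩ y hy
  have h2 := fderiv_sub_le_of_convexOn hf.convex hf.differentiable x y
  have h3 := hH x hx
  rw [hdist, dist_eq_norm] at h3
  rw [← hopt] at h2
  set h := f x - optValue C f with hh
  set w := strongWolfeGap C f x
  -- Convexity and scaling give `h ≤ ‖x - y‖ w / δ`. As `y` is a nearest minimizer, HEB bounds `‖x -
  -- y‖` by `c h ^ θ`; it remains to divide by `h ^ θ` and take the root.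
  have h4 : h ≤ c / δ * w * h ^ θ := by
    rw [map_smul, smul_eq_mul] at h1
    have h5 : δ * (‖x - y‖⁻¹ * h) ≤ w := le_trans (by gcongr) h1
    have h6 : h ≤ ‖x - y‖ * (w / δ) := by
      rw [← mul_assoc, ← div_eq_mul_inv] at h5
      have h7 : δ / ‖x - y‖ * h * (‖x - y‖ / δ) = h := by field_simp
      calc h = δ / ‖x - y‖ * h * (‖x - y‖ / δ) := h7.symm
        _ ≤ w * (‖x - y‖ / δ) := mul_le_mul_of_nonneg_right h5 (by positivity)
        _ = ‖x - y‖ * (w / δ) := by ring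
    calc h ≤ ‖x - y‖ * (w / δ) := h6
      _ ≤ c * h ^ θ * (w / δ) := mul_le_mul_of_nonneg_right h3 (by positivity)
      _ = c / δ * w * h ^ θ := by ring
  have h8 : h ^ (1 - θ) ≤ c / δ * w := by
    rw [Real.rpow_sub hpos, Real.rpow_one, div_le_iff₀ (by positivity)]
    exact h4
  have h9 : 0 < 1 - θ := by linarith
  calc h = (h ^ (1 - θ)) ^ (1 / (1 - θ)) := by
        rw [← Real.rpow_mul hpos.le, mul_one_div_cancel h9.ne', Real.rpow_one]
    _ ≤ (c / δ * w) ^ (1 / (1 - θ)) := Real.rpow_le_rpow (by positivity) h8 (by positivity)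
    _ = _ := Real.mul_rpow hcδ.le hw

theorem IsActiveRep.sub_optValue_le_gap_rpow (hC : IsPolytope C) (hf : IsSmoothConvex C f)
    {θ c δ : ℝ} (hθ : θ < 1) (hc : 0 < c) (hδ : 0 < δ) (hH : HEB C f θ c) (hS : Scaling C δ)
    {α : E →₀ ℝ} (hα : IsActiveRep C α) :
    f (point α) - optValue C f ≤ (c / δ) ^ (1 / (1 - θ)) * gap C f α ^ (1 / (1 - θ)) := by
  have hx := hα.point_mem hC.convex
  refine (sub_optValue_le_strongWolfeGap_rpow hC hf hθ hc hδ hH hS hx).trans ?_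
  have h1 : 0 < 1 - θ := by linarith
  exact mul_le_mul_of_nonneg_left (Real.rpow_le_rpow (strongWolfeGap_nonneg hC hx)
    (hα.strongWolfeGap_le_gap hC) (by positivity)) (by positivity)

theorem exists_HEB_zero (hC : IsCompact C) (hd : Differentiable ℝ f) :
    ∃ c : ℝ, 0 < c ∧ HEB C f 0 c := by
  have h0 : 0 ≤ Metric.diam C := Metric.diam_nonneg
  refine ⟨Metric.diam C + 1, by linarith, fun x hx => ?_⟩
  obtain ⟨y, hy⟩ := minimizers_nonempty hC ⟨x, hx⟩ hd
  -- With `0 ^ 0 = 1` the bound for `θ = 0` only asks that distances to the minimizers be bounded;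
  -- the `+ 1` keeps `c` positive when `C` is a point.
  rw [Real.rpow_zero, mul_one]
  have h1 := Metric.infDist_le_dist_of_mem (x := x) hy
  have h2 := Metric.dist_le_diam_of_mem hC.isBounded hx hy.1
  linarith

/-- Quadratic growth of a strongly convex function at a minimizer. -/
theorem sq_norm_sub_le_of_strongConvexOn {m : ℝ} (h : StrongConvexOn C m f)
    {x y : E} (hx : x ∈ C) (hy : y ∈ minimizers C f) : m / 2 * ‖x - y‖ ^ 2 ≤ f x - f y := by
  -- Strong convexity at `(1 - b)x + by`, where `f` is at least `f y`, gives this after division by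
  -- `1 - b`; then `b → 1`.
  have key : ∀ b ∈ Ioo (0 : ℝ) 1, b * (m / 2 * ‖x - y‖ ^ 2) ≤ f x - f y := by
    intro b hb
    have ha : 0 < 1 - b := by linarith [hb.2]
    have hsum : (1 - b) + b = 1 := by ring
    have h1 := h.2 hx hy.1 ha.le hb.1.le hsum
    have h2 : f y ≤ f ((1 - b) • x + b • y) := hy.2 (h.1 hx hy.1 ha.le hb.1.le hsum)
    simp only [smul_eq_mul] at h1
    refine le_of_mul_le_mul_left ?_ ha
    nlinarith
  have ht : Tendsto (fun b : ℝ => b * (m / 2 * ‖x - y‖ ^ 2)) (𝓝[<] 1)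
      (𝓝 (1 * (m / 2 * ‖x - y‖ ^ 2))) :=
    ((continuous_id.mul continuous_const).tendsto 1).mono_left nhdsWithin_le_nhds
  rw [one_mul] at ht
  exact le_of_tendsto ht (by
    filter_upwards [Ioo_mem_nhdsLT (zero_lt_one (α := ℝ))] with b hb using key b hb)

theorem exists_HEB_half_of_strongConvexOn (hC : IsCompact C) (hd : Differentiable ℝ f) {m : ℝ}
    (hm : 0 < m) (h : StrongConvexOn C m f) : ∃ c : ℝ, 0 < c ∧ HEB C f (1 / 2) c := by
  refine ⟨√(2 / m), by positivity, fun x hx => ?_⟩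
  obtain ⟨y, hy⟩ := minimizers_nonempty hC ⟨x, hx⟩ hd
  have h1 := sq_norm_sub_le_of_strongConvexOn h hx hy
  have h2 := Metric.infDist_le_dist_of_mem (x := x) hy
  rw [dist_eq_norm] at h2
  rw [← Real.sqrt_eq_rpow, ← Real.sqrt_mul (by positivity), optValue_eq hy]
  refine h2.trans (Real.le_sqrt_of_sq_le ?_)
  calc ‖x - y‖ ^ 2 = 2 / m * (m / 2 * ‖x - y‖ ^ 2) := by field_simp
    _ ≤ 2 / m * (f x - f y) := mul_le_mul_of_nonneg_left h1 (by positivity)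

end ErrorBound

/-! ### Accumulation over the calls -/

section Restart

variable {γ ε : ℝ} {α₀ α β : E →₀ ℝ} {T n : ℕ}

theorem RestartRun.isActiveRep (hα₀ : IsActiveRep C α₀) (h : RestartRun C f γ ε α₀ T α) :
    IsActiveRep C α := by
  induction h with
  | refl => exact hα₀
  | restart _ _ hout ih => exact hout.1.isActiveRep ih

theorem RestartRun.gap_le (hC : IsPolytope C) (hγ : 0 < γ) (hα₀ : IsActiveRep C α₀)
    (h : RestartRun C f γ ε α₀ T α) : gap C f α ≤ gap C f α₀ := by
  induction h with
  | refl => exact le_rfl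
  | @restart T n α β hr _ hout ih =>
    have h0 : 0 ≤ gap C f α := (hr.isActiveRep hα₀).gap_nonneg hC
    have h1 : Real.exp (-γ) ≤ 1 := Real.exp_le_one_iff.2 (by linarith)
    exact hout.2.trans ((mul_le_of_le_one_left h0 h1).trans ih)

/-- The number of iterations of one call, up to the change of the active set. -/
theorem FracRun.iterations_le (hC : IsPolytope C) (hf : IsSmoothConvex C f) {K μ r : ℝ}
    (hcurv : CurvatureLE C f K) (hK : 0 < K) (hα : IsActiveRep C α)
    (hprimal : f (point α) - optValue C f ≤ μ * gap C f α ^ r)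
    (hW : 0 < gap C f α) (hWK : Real.exp (-γ) * gap C f α / 2 ≤ K)
    (h : FracRun C f γ (gap C f α) α n β) :
    (n + β.support.card - α.support.card) * gap C f α ^ (2 - r) ≤
      16 * Real.exp (2 * γ) * K * μ := by
  have h1 := h.progress hC hf hcurv hK hW.le hWK hα
  have h2 := optValue_le hC.isCompact hf.differentiable
    ((h.isActiveRep hα).point_mem hC.convex)
  have hsq : gap C f α ^ 2 = gap C f α ^ (2 - r) * gap C f α ^ r := by
    rw [← Real.rpow_add hW, sub_add_cancel, Real.rpow_two]
  have hr : 0 < gap C f α ^ r := Real.rpow_pos_of_pos hW r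
  have hA : 0 ≤ 16 * K * Real.exp (2 * γ) := by positivity
  refine le_of_mul_le_mul_right ?_ hr
  calc (n + β.support.card - α.support.card) * gap C f α ^ (2 - r) * gap C f α ^ r
      = gap C f α ^ 2 * (n + β.support.card - α.support.card) := by rw [hsq]; ring
    _ ≤ 16 * K * Real.exp (2 * γ) * (f (point α) - f (point β)) := h1
    _ ≤ 16 * K * Real.exp (2 * γ) * (μ * gap C f α ^ r) :=
        mul_le_mul_of_nonneg_left (by linarith) hA
    _ = _ := by ring

theorem rateConst_eq {γ r K μ w₀ : ℝ} (hw₀ : 0 ≤ w₀) :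
    rateConst γ r K μ w₀ =
      (Real.exp (γ * (2 - r)) - 1) / (16 * Real.exp (2 * γ) * K * μ) * w₀ ^ (2 - r) := by
  rw [rateConst, ← neg_sub 2 r, Real.rpow_neg hw₀, ← div_div, div_inv_eq_mul]

/-- The gap along the restart scheme for exponents below two. -/
theorem RestartRun.rate_of_lt_two (hC : IsPolytope C) (hf : IsSmoothConvex C f) (hγ : 0 < γ)
    (hε : 0 < ε) {K μ r : ℝ} (hcurv : CurvatureLE C f K) (hK : 0 < K) (hμ : 0 < μ) (hr : r < 2)
    (hprimal : ∀ α, IsActiveRep C α → f (point α) - optValue C f ≤ μ * gap C f α ^ r)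
    (hα₀ : IsActiveRep C α₀) (hWK : Real.exp (-γ) * gap C f α₀ / 2 ≤ K)
    (h : RestartRun C f γ ε α₀ T α) :
    (1 + (T + α.support.card - α₀.support.card) * rateConst γ r K μ (gap C f α₀)) *
      gap C f α ^ (2 - r) ≤ gap C f α₀ ^ (2 - r) := by
  induction h with
  | refl => simp
  | @restart T n α β hrun hgt hout ih =>
    have hα := hrun.isActiveRep hα₀
    have hβ := hout.1.isActiveRep hα
    have hW : 0 < gap C f α := hε.trans (hgt.trans_le (hα.strongWolfeGap_le_gap hC))
    have hle : gap C f α ≤ gap C f α₀ := hrun.gap_le hC hγ hα₀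
    have hWK' : Real.exp (-γ) * gap C f α / 2 ≤ K := le_trans (by gcongr) hWK
    have hn := hout.1.iterations_le hC hf hcurv hK hα (hprimal α hα) hW hWK'
    rw [rateConst_eq (hW.le.trans hle)] at ih ⊢
    have hq : 0 < 2 - r := by linarith
    set q := 2 - r
    set W := gap C f α
    set w₀ := gap C f α₀
    set A := 16 * Real.exp (2 * γ) * K * μ with hA
    have hApos : 0 < A := by positivity
    have hw₀ : 0 ≤ w₀ ^ q := Real.rpow_nonneg (hW.le.trans hle) q
    have hexp : 0 ≤ Real.exp (γ * q) - 1 := sub_nonneg.2 (Real.one_le_exp (by positivity))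
    -- A call adds at most `(e^{γq} - 1) w₀^q` to the left side of the invariant, raising the bound
    -- to `e^{γq} w₀^q`. The new gap contributes the compensating factor `e^{-γq}`, which explains
    -- the numerator of `rateConst`.
    have h1 : (n + β.support.card - α.support.card) *
        ((Real.exp (γ * q) - 1) / A * w₀ ^ q) * W ^ q ≤ (Real.exp (γ * q) - 1) * w₀ ^ q := by
      have := mul_le_mul_of_nonneg_left hn
        (show 0 ≤ (Real.exp (γ * q) - 1) / A * w₀ ^ q by positivity)
      calc _ = (Real.exp (γ * q) - 1) / A * w₀ ^ q *
            ((n + β.support.card - α.support.card) * W ^ q) := by ring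
        _ ≤ _ := this
        _ = _ := by field_simp
    have h2 : gap C f β ^ q ≤ Real.exp (-(γ * q)) * W ^ q := by
      calc gap C f β ^ q ≤ (Real.exp (-γ) * W) ^ q :=
            Real.rpow_le_rpow (hβ.gap_nonneg hC) hout.2 hq.le
        _ = _ := by
            rw [Real.mul_rpow (Real.exp_pos _).le hW.le, ← Real.exp_mul, neg_mul]
    set X := 1 + ((T + n : ℕ) + β.support.card - α₀.support.card : ℝ) *
      ((Real.exp (γ * q) - 1) / A * w₀ ^ q) with hX
    have h3 : X * W ^ q ≤ Real.exp (γ * q) * w₀ ^ q := by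
      rw [hX]
      push_cast
      linarith
    -- The adjusted count can be negative, since a full Frank-Wolfe step may discard many vertices
    -- at once.
    rcases le_or_gt X 0 with hX0 | hX0
    · exact (mul_nonpos_of_nonpos_of_nonneg hX0
        (Real.rpow_nonneg (hβ.gap_nonneg hC) q)).trans hw₀
    calc X * gap C f β ^ q ≤ X * (Real.exp (-(γ * q)) * W ^ q) :=
          mul_le_mul_of_nonneg_left h2 hX0.le
      _ = Real.exp (-(γ * q)) * (X * W ^ q) := by ring
      _ ≤ Real.exp (-(γ * q)) * (Real.exp (γ * q) * w₀ ^ q) :=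
          mul_le_mul_of_nonneg_left h3 (Real.exp_pos _).le
      _ = w₀ ^ q := by rw [← mul_assoc, ← Real.exp_add, neg_add_cancel, Real.exp_zero, one_mul]

/-- The gap along the restart scheme for exponent two. -/
theorem RestartRun.rate_two (hC : IsPolytope C) (hf : IsSmoothConvex C f) (hγ : 0 < γ)
    (hε : 0 < ε) {K μ : ℝ} (hcurv : CurvatureLE C f K) (hK : 0 < K) (hμ : 0 < μ)
    (hprimal : ∀ α, IsActiveRep C α → f (point α) - optValue C f ≤ μ * gap C f α ^ (2 : ℝ))
    (hα₀ : IsActiveRep C α₀) (hWK : Real.exp (-γ) * gap C f α₀ / 2 ≤ K)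
    (h : RestartRun C f γ ε α₀ T α) :
    gap C f α ≤ gap C f α₀ * Real.exp (-(γ / (16 * Real.exp (2 * γ) * K * μ) *
      (T + α.support.card - α₀.support.card))) := by
  induction h with
  | refl => simp
  | @restart T n α β hrun hgt hout ih =>
    have hα := hrun.isActiveRep hα₀
    have hW : 0 < gap C f α := hε.trans (hgt.trans_le (hα.strongWolfeGap_le_gap hC))
    have hle : gap C f α ≤ gap C f α₀ := hrun.gap_le hC hγ hα₀
    have hWK' : Real.exp (-γ) * gap C f α / 2 ≤ K := le_trans (by gcongr) hWK
    have hn := hout.1.iterations_le hC hf hcurv hK hα (hprimal α hα) hW hWK'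
    rw [sub_self, Real.rpow_zero, mul_one] at hn
    set A := 16 * Real.exp (2 * γ) * K * μ with hA
    have hApos : 0 < A := by positivity
    -- For `r = 2` the adjusted length of a call is at most `A` whatever its gap, so the factor
    -- `e^{-γ}` pays for all of it.
    have h1 : γ / A * (n + β.support.card - α.support.card) ≤ γ := by
      calc _ ≤ γ / A * A := mul_le_mul_of_nonneg_left hn (by positivity)
        _ = γ := div_mul_cancel₀ _ hApos.ne'
    calc gap C f β ≤ Real.exp (-γ) * gap C f α := hout.2
      _ ≤ Real.exp (-γ) * (gap C f α₀ * Real.exp (-(γ / A *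
          (T + α.support.card - α₀.support.card)))) := by gcongr
      _ = gap C f α₀ * Real.exp (-γ + -(γ / A * (T + α.support.card - α₀.support.card))) := by
          rw [Real.exp_add]
          ring
      _ ≤ _ := by
          refine mul_le_mul_of_nonneg_left (Real.exp_le_exp.2 ?_) (hW.le.trans hle)
          push_cast
          linarith

/-- Every iterate but the first lies in a call of the inner algorithm. -/
theorem IsIterate.eq_zero_or_exists {t : ℕ} (h : IsIterate C f γ ε α₀ t β) :
    (t = 0 ∧ β = α₀) ∨ ∃ (T n : ℕ) (α : E →₀ ℝ), RestartRun C f γ ε α₀ T α ∧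
      ε < strongWolfeGap C f (point α) ∧ FracRun C f γ (gap C f α) α n β ∧ t = T + n := by
  rcases h with h | h
  · cases h with
    | refl => exact Or.inl ⟨rfl, rfl⟩
    | @restart T n α _ hr hgt hout => exact Or.inr ⟨T, n, α, hr, hgt, hout.1, rfl⟩
  · exact Or.inr h

theorem IsIterate.isActiveRep (hα₀ : IsActiveRep C α₀) {t : ℕ} (h : IsIterate C f γ ε α₀ t β) :
    IsActiveRep C β := by
  rcases h.eq_zero_or_exists with ⟨-, rfl⟩ | ⟨T, n, α, hr, -, hrun, -⟩
  · exact hα₀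
  · exact hrun.isActiveRep (hr.isActiveRep hα₀)

/-- A scheme whose total number of iterations is bounded reaches an output. -/
theorem exists_isOutput (hC : IsPolytope C) (hf : IsSmoothConvex C f) (hγ : 0 < γ) (hε : 0 < ε)
    (hα₀ : IsActiveRep C α₀) {N : ℕ} (hN : ∀ t α, IsIterate C f γ ε α₀ t α → t ≤ N) :
    ∃ T α, IsOutput C f γ ε α₀ T α := by
  -- `k` is the remaining budget: when it reaches `0`, an iterate beyond `N` would exist.
  have inner : ∀ (k T n : ℕ) (α β : E →₀ ℝ), N < T + n + k → RestartRun C f γ ε α₀ T α →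
      ε < strongWolfeGap C f (point α) → FracRun C f γ (gap C f α) α n β →
      ∃ n' β', FracOutput C f γ α n' β' := by
    intro k
    induction k with
    | zero =>
      intro T n α β hlt hr hgt hrun
      exact absurd (hN _ β (Or.inr ⟨T, n, α, hr, hgt, hrun, rfl⟩)) (by omega)
    | succ k ih =>
      intro T n α β hlt hr hgt hrun
      rcases le_or_gt (gap C f β) (Real.exp (-γ) * gap C f α) with hle | hlt'
      · exact ⟨n, β, hrun, hle⟩
      · obtain ⟨β', hβ'⟩ := exists_fracStep hC hf
          (hrun.isActiveRep (hr.isActiveRep hα₀)) hlt'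
        exact ih T (n + 1) α β' (by omega) hr hgt (hrun.step hβ')
  have outer : ∀ (k T : ℕ) (α : E →₀ ℝ), N < T + k → RestartRun C f γ ε α₀ T α →
      ∃ T α, IsOutput C f γ ε α₀ T α := by
    intro k
    induction k with
    | zero =>
      intro T α hlt hr
      exact absurd (hN _ α (Or.inl hr)) (by omega)
    | succ k ih =>
      intro T α hlt hr
      rcases le_or_gt (strongWolfeGap C f (point α)) ε with hle | hgt
      · exact ⟨T, α, hr, hle⟩
      obtain ⟨n, β, hout⟩ := inner (N + 1) T 0 α α (by omega) hr hgt FracRun.refl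
      -- A call from a positive gap cannot stop at once because `e^{-γ} < 1`, so every call consumes
      -- budget.
      have hn : n ≠ 0 := by
        rintro rfl
        obtain ⟨hrun, hle⟩ := hout
        cases hrun
        have hW : 0 < gap C f α :=
          hε.trans (hgt.trans_le ((hr.isActiveRep hα₀).strongWolfeGap_le_gap hC))
        have := mul_lt_of_lt_one_left hW (Real.exp_lt_one_iff.2 (neg_lt_zero.2 hγ))
        linarith
      exact ih (T + n) β (by omega) (hr.restart hgt hout)
  exact outer (N + 1) 0 α₀ (by omega) RestartRun.refl

theorem exists_gap_le (hC : IsPolytope C) (hf : IsSmoothConvex C f) :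
    ∃ B : ℝ, 0 ≤ B ∧ ∀ α, IsActiveRep C α → gap C f α ≤ B := by
  obtain ⟨B, hB, h⟩ := exists_fderiv_sub_le hC.isCompact hf
  refine ⟨B, hB, fun α hα => Real.sSup_le ?_ hB⟩
  rintro a ⟨y, hy, z, hz, rfl⟩
  exact h _ (hα.point_mem hC.convex) _ (extremePoints_subset (hα.extreme y hy)) _ hz

/-- A curvature bound that makes the burn-in phase empty, uniformly in the starting point. -/
theorem exists_curvatureLE (hC : IsPolytope C) (hf : IsSmoothConvex C f) (hγ : 0 < γ) :
    ∃ K : ℝ, 0 < K ∧ CurvatureLE C f K ∧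
      ∀ α, IsActiveRep C α → Real.exp (-γ) * gap C f α / 2 ≤ K := by
  obtain ⟨B, hB, h⟩ := exists_gap_le hC hf
  have h0 := awayCurvature_nonneg hC.convex hC.isCompact hC.nonempty hf
  refine ⟨awayCurvature C f + B + 1, by linarith,
    (curvatureLE_awayCurvature hC.convex hC.isCompact hf).mono (by linarith), fun α hα => ?_⟩
  have h1 := mul_le_of_le_one_left (hα.gap_nonneg (f := f) hC)
    (Real.exp_le_one_iff.2 (neg_nonpos.2 hγ.le))
  linarith [h α hα, hα.gap_nonneg (f := f) hC]

/-- The sublinear rate, without any burn-in assumption. -/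
theorem exists_iterations_mul_gap_le (hC : IsPolytope C) (hf : IsSmoothConvex C f) (hγ : 0 < γ) :
    ∃ D : ℝ, 0 ≤ D ∧ ∀ ε : ℝ, 0 < ε → ∀ α₀ : E →₀ ℝ, IsActiveRep C α₀ →
      ∀ (T n : ℕ) (α β : E →₀ ℝ), RestartRun C f γ ε α₀ T α →
        ε < strongWolfeGap C f (point α) → FracRun C f γ (gap C f α) α n β →
        ((T + n : ℕ) - (C.extremePoints ℝ).ncard : ℝ) * gap C f α ≤ D := by
  obtain ⟨K, hK, hcurv, hburn⟩ := exists_curvatureLE hC hf hγ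
  obtain ⟨c, hc, hH⟩ := exists_HEB_zero hC.isCompact hf.differentiable
  obtain ⟨δ, hδ, hS⟩ := hC.exists_scaling
  have hprimal : ∀ α, IsActiveRep C α →
      f (point α) - optValue C f ≤ c / δ * gap C f α ^ (1 : ℝ) := by
    intro α hα
    simpa using hα.sub_optValue_le_gap_rpow hC hf zero_lt_one hc hδ hH hS
  have hμ : 0 < c / δ := div_pos hc hδ
  set μ := c / δ
  have hexp : 0 < Real.exp γ - 1 := sub_pos.2 (Real.one_lt_exp_iff.2 hγ)
  -- The first summand accounts for the completed calls (rate for `r = 1`), the second for the call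
  -- in progress.
  refine ⟨16 * Real.exp (2 * γ) * K * μ / (Real.exp γ - 1) + 16 * Real.exp (2 * γ) * K * μ,
    by positivity, fun ε hε α₀ hα₀ T n α β hr hgt hrun => ?_⟩
  have hα := hr.isActiveRep hα₀
  have hβ := hrun.isActiveRep hα
  have hW : 0 < gap C f α := hε.trans (hgt.trans_le (hα.strongWolfeGap_le_gap hC))
  have hw₀ : 0 < gap C f α₀ := hW.trans_le (hr.gap_le hC hγ hα₀)
  have h1 := hr.rate_of_lt_two hC hf hγ hε hcurv hK hμ one_lt_two hprimal hα₀ (hburn _ hα₀)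
  have h2 := hrun.iterations_le hC hf hcurv hK hα (hprimal α hα) hW (hburn _ hα)
  rw [rateConst_eq hw₀.le] at h1
  have h21 : (2 - 1 : ℝ) = 1 := by norm_num
  rw [h21, mul_one, Real.rpow_one, Real.rpow_one] at h1
  rw [h21, Real.rpow_one] at h2
  set A := 16 * Real.exp (2 * γ) * K * μ with hA
  have hApos : 0 < A := by positivity
  have h3 : (T + α.support.card - α₀.support.card) * gap C f α ≤ A / (Real.exp γ - 1) := by
    rw [le_div_iff₀ hexp]
    have h4 : ((T + α.support.card - α₀.support.card) * gap C f α * (Real.exp γ - 1)) / A *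
        gap C f α₀ ≤ 1 * gap C f α₀ := by
      calc _ = (T + α.support.card - α₀.support.card) *
            ((Real.exp γ - 1) / A * gap C f α₀) * gap C f α := by ring
        _ ≤ _ := by linarith
    exact (div_le_one hApos).1 (le_of_mul_le_mul_right h4 hw₀)
  -- The cardinalities telescope to `|S_β| - |S₀|`, which is at least minus the number of vertices.
  have h5 : ((T + n : ℕ) - (C.extremePoints ℝ).ncard : ℝ) ≤
      (T + α.support.card - α₀.support.card) + (n + β.support.card - α.support.card) := by
    have h6 : (α₀.support.card : ℝ) ≤ (C.extremePoints ℝ).ncard := by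
      exact_mod_cast hα₀.card_le hC
    have h7 : (0 : ℝ) ≤ β.support.card := Nat.cast_nonneg _
    push_cast
    linarith
  calc _ ≤ ((T + α.support.card - α₀.support.card) + (n + β.support.card - α.support.card)) *
        gap C f α := mul_le_mul_of_nonneg_right h5 hW.le
    _ ≤ _ := by linarith

end Restart

/-! ### Termination and convergence rates -/

section Rates

variable {γ : ℝ}

/-- Any call in progress started from a gap above `ε`, so the bound on iterations times gap becomes
a bound on iterations. -/
theorem restart_terminates (hC : IsPolytope C) (hf : IsSmoothConvex C f) (hγ : 0 < γ) {ε : ℝ}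
    (hε : 0 < ε) : ∃ N : ℕ, ∀ α₀ : E →₀ ℝ, IsActiveRep C α₀ →
      (∀ t α, IsIterate C f γ ε α₀ t α → t ≤ N) ∧ ∃ T α, IsOutput C f γ ε α₀ T α := by
  obtain ⟨D, hD, h⟩ := exists_iterations_mul_gap_le hC hf hγ
  obtain ⟨N, hN⟩ := exists_nat_ge ((C.extremePoints ℝ).ncard + D / ε)
  refine ⟨N, fun α₀ hα₀ => ?_⟩
  have hbound : ∀ t α, IsIterate C f γ ε α₀ t α → t ≤ N := by
    intro t β hit
    rcases hit.eq_zero_or_exists with ⟨rfl, -⟩ | ⟨T, n, α, hr, hgt, hrun, rfl⟩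
    · exact Nat.zero_le _
    have h1 := h ε hε α₀ hα₀ T n α β hr hgt hrun
    have hW : ε < gap C f α := hgt.trans_le ((hr.isActiveRep hα₀).strongWolfeGap_le_gap hC)
    suffices ((T + n : ℕ) : ℝ) - (C.extremePoints ℝ).ncard ≤ D / ε by
      have : ((T + n : ℕ) : ℝ) ≤ N := by linarith
      exact_mod_cast this
    rcases le_or_gt (((T + n : ℕ) : ℝ) - (C.extremePoints ℝ).ncard) 0 with h0 | h0
    · exact h0.trans (by positivity)
    · rw [le_div_iff₀ hε]
      exact (mul_le_mul_of_nonneg_left hW.le h0.le).trans h1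
  exact ⟨hbound, exists_isOutput hC hf hγ hε hα₀ hbound⟩

theorem exists_sublinear_rate (hC : IsPolytope C) (hf : IsSmoothConvex C f) (hγ : 0 < γ) :
    ∃ M : ℝ, ∀ ε : ℝ, 0 < ε → ∀ α₀ : E →₀ ℝ, IsActiveRep C α₀ →
      ∀ t α, IsIterate C f γ ε α₀ t α → 0 < t → f (point α) - optValue C f ≤ M / t := by
  obtain ⟨D, hD, h⟩ := exists_iterations_mul_gap_le hC hf hγ
  obtain ⟨B, hB, hgap⟩ := exists_gap_le hC hf
  -- `D` bounds `t - |Ext C|` times the primal gap; the remaining `|Ext C|` copies of that gap are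
  -- each at most `B`.
  refine ⟨D + (C.extremePoints ℝ).ncard * B, fun ε hε α₀ hα₀ t β hit ht => ?_⟩
  have hβ := hit.isActiveRep hα₀
  rcases hit.eq_zero_or_exists with ⟨rfl, -⟩ | ⟨T, n, α, hr, hgt, hrun, rfl⟩
  · exact absurd ht (lt_irrefl 0)
  have hα := hr.isActiveRep hα₀
  have h1 := h ε hε α₀ hα₀ T n α β hr hgt hrun
  have h2 : f (point β) - optValue C f ≤ gap C f α :=
    (sub_le_sub_right (hrun.apply_point_le hα) _).trans (hα.sub_optValue_le_gap hC hf)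
  have h3 := optValue_le hC.isCompact hf.differentiable (hβ.point_mem hC.convex)
  have h4 : f (point β) - optValue C f ≤ B := h2.trans (hgap α hα)
  rw [le_div_iff₀ (by exact_mod_cast ht)]
  have h5 : ((T + n : ℕ) - (C.extremePoints ℝ).ncard : ℝ) * (f (point β) - optValue C f) ≤ D := by
    rcases le_or_gt (((T + n : ℕ) : ℝ) - (C.extremePoints ℝ).ncard) 0 with h0 | h0
    · exact (mul_nonpos_of_nonpos_of_nonneg h0 (sub_nonneg.2 h3)).trans hD
    · exact (mul_le_mul_of_nonneg_left h2 h0.le).trans h1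
  have h6 := mul_le_mul_of_nonneg_left h4 (Nat.cast_nonneg (α := ℝ) (C.extremePoints ℝ).ncard)
  linarith

theorem exists_linear_rate (hC : IsPolytope C) (hf : IsSmoothConvex C f) (hγ : 0 < γ) {c : ℝ}
    (hc : 0 < c) (hH : HEB C f (1 / 2) c) :
    ∃ M ρ : ℝ, 0 < ρ ∧ ρ < 1 ∧ ∀ ε : ℝ, 0 < ε → ∀ α₀ : E →₀ ℝ, IsActiveRep C α₀ →
      ∀ t α, IsIterate C f γ ε α₀ t α → f (point α) - optValue C f ≤ M * ρ ^ t := by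
  obtain ⟨K, hK, hcurv, hburn⟩ := exists_curvatureLE hC hf hγ
  obtain ⟨δ, hδ, hS⟩ := hC.exists_scaling
  obtain ⟨B, hB, hgap⟩ := exists_gap_le hC hf
  have hr2 : (1 / (1 - 1 / 2) : ℝ) = 2 := by norm_num
  have hμ : 0 < (c / δ) ^ (2 : ℝ) := Real.rpow_pos_of_pos (div_pos hc hδ) _
  have hprimal : ∀ α, IsActiveRep C α →
      f (point α) - optValue C f ≤ (c / δ) ^ (2 : ℝ) * gap C f α ^ (2 : ℝ) := by
    intro α hα
    have := hα.sub_optValue_le_gap_rpow hC hf one_half_lt_one hc hδ hH hS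
    rwa [hr2] at this
  set μ := (c / δ) ^ (2 : ℝ)
  set A := 16 * Real.exp (2 * γ) * K * μ with hA
  have hApos : 0 < A := by positivity
  have hcA : 0 < γ / A := by positivity
  -- The exponent makes up for iterations outside the rate at the start of the current call: at most
  -- `|Ext C|` from the active sets, plus `A` for the unfinished call.
  refine ⟨B * Real.exp (γ / A * ((C.extremePoints ℝ).ncard + A)), Real.exp (-(γ / A)),
    Real.exp_pos _, Real.exp_lt_one_iff.2 (neg_lt_zero.2 hcA), fun ε hε α₀ hα₀ t β hit => ?_⟩
  have hβ := hit.isActiveRep hα₀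
  rcases hit.eq_zero_or_exists with ⟨rfl, -⟩ | ⟨T, n, α, hr, hgt, hrun, rfl⟩
  · rw [pow_zero, mul_one]
    exact ((hβ.sub_optValue_le_gap hC hf).trans (hgap β hβ)).trans
      (le_mul_of_one_le_right hB (Real.one_le_exp (by positivity)))
  have hα := hr.isActiveRep hα₀
  have hW : 0 < gap C f α := hε.trans (hgt.trans_le (hα.strongWolfeGap_le_gap hC))
  have h1 := hr.rate_two hC hf hγ hε hcurv hK hμ hprimal hα₀ (hburn _ hα₀)
  have h2 := hrun.iterations_le hC hf hcurv hK hα (hprimal α hα) hW (hburn _ hα)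
  rw [sub_self, Real.rpow_zero, mul_one] at h2
  have h3 : (α₀.support.card : ℝ) ≤ (C.extremePoints ℝ).ncard := by
    exact_mod_cast hα₀.card_le hC
  have h4 : (0 : ℝ) ≤ β.support.card := Nat.cast_nonneg _
  calc f (point β) - optValue C f ≤ gap C f α :=
        (sub_le_sub_right (hrun.apply_point_le hα) _).trans (hα.sub_optValue_le_gap hC hf)
    _ ≤ gap C f α₀ * Real.exp (-(γ / A * (T + α.support.card - α₀.support.card))) := h1
    _ ≤ B * Real.exp (-(γ / A * (T + α.support.card - α₀.support.card))) :=
        mul_le_mul_of_nonneg_right (hgap _ hα₀) (Real.exp_pos _).le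
    _ ≤ B * Real.exp (γ / A * ((C.extremePoints ℝ).ncard + A) + (T + n : ℕ) * -(γ / A)) := by
        refine mul_le_mul_of_nonneg_left (Real.exp_le_exp.2 ?_) hB
        have h5 := mul_le_mul_of_nonneg_left (show (0 : ℝ) ≤ (C.extremePoints ℝ).ncard + A -
          (T + n) + (T + α.support.card - α₀.support.card) by linarith) hcA.le
        push_cast
        linarith
    _ = _ := by rw [Real.exp_add, Real.exp_nat_mul, mul_assoc]

/-- Rates of the output under the Hölderian error bound, after the burn-in phase. -/
theorem output_rate (hC : IsPolytope C) (hf : IsSmoothConvex C f) (hγ : 0 < γ)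
    {θ c δ r μ : ℝ} (hθ : θ < 1) (hc : 0 < c) (hδ : 0 < δ) (hH : HEB C f θ c) (hS : Scaling C δ)
    (hr : r = 1 / (1 - θ)) (hμ : μ = (c / δ) ^ r) {ε : ℝ} (hε : 0 < ε) {α₀ : E →₀ ℝ}
    (hα₀ : IsActiveRep C α₀) (hburn : Real.exp (-γ) * gap C f α₀ / 2 ≤ awayCurvature C f)
    {T : ℕ} {α : E →₀ ℝ} (hrun : RestartRun C f γ ε α₀ T α) :
    (r < 2 → f (point α) - optValue C f ≤
      gap C f α₀ * (1 / (1 + effectiveSteps α₀ T α *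
        rateConst γ r (awayCurvature C f) μ (gap C f α₀)) ^ (1 / (2 - r)))) ∧
    (r = 2 → f (point α) - optValue C f ≤
      gap C f α₀ * Real.exp (-(γ / Real.exp (2 * γ) *
        (effectiveSteps α₀ T α / (16 * awayCurvature C f * μ))))) := by
  have hα := hrun.isActiveRep hα₀
  have hle : f (point α) - optValue C f ≤ gap C f α := hα.sub_optValue_le_gap hC hf
  have hgle : gap C f α ≤ gap C f α₀ := hrun.gap_le hC hγ hα₀
  have hW : 0 ≤ gap C f α := hα.gap_nonneg hC
  -- If `w₀ = 0` both sides are settled directly. Otherwise the burn-in hypothesis forces positive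
  -- curvature, so no division by zero remains.
  rcases eq_or_lt_of_le (hW.trans hgle) with hw₀ | hw₀
  · rw [← hw₀, zero_mul, zero_mul]
    rw [← hw₀] at hgle
    exact ⟨fun _ => hle.trans hgle, fun _ => hle.trans hgle⟩
  have hK : 0 < awayCurvature C f := lt_of_lt_of_le (by positivity) hburn
  have hμ0 : 0 < μ := hμ ▸ Real.rpow_pos_of_pos (div_pos hc hδ) _
  have hcurv := curvatureLE_awayCurvature hC.convex hC.isCompact hf
  have hprimal : ∀ α, IsActiveRep C α → f (point α) - optValue C f ≤ μ * gap C f α ^ r := by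
    intro α hα
    rw [hμ, hr]
    exact hα.sub_optValue_le_gap_rpow hC hf hθ hc hδ hH hS
  set K := awayCurvature C f
  set w₀ := gap C f α₀
  set T' : ℝ := (T : ℝ) - ((α₀.support.card : ℝ) - (α.support.card : ℝ)) with hT'
  have hT'' : (T : ℝ) + α.support.card - α₀.support.card = T' := by rw [hT']; ring
  have heff : effectiveSteps α₀ T α = max 0 T' := rfl
  refine ⟨fun hr2 => hle.trans ?_, fun hr2 => hle.trans ?_⟩
  · have h1 := hrun.rate_of_lt_two hC hf hγ hε hcurv hK hμ0 hr2 hprimal hα₀ hburn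
    have hq : 0 < 2 - r := by linarith
    have hR : 0 ≤ rateConst γ r K μ w₀ := by
      have : 0 ≤ Real.exp (γ * (2 - r)) - 1 := sub_nonneg.2 (Real.one_le_exp (by positivity))
      rw [rateConst]
      positivity
    rw [hT''] at h1
    have h2 : (1 + max 0 T' * rateConst γ r K μ w₀) * gap C f α ^ (2 - r) ≤ w₀ ^ (2 - r) := by
      -- Where the count is truncated to `0`, the claim is just monotonicity of the gap.
      rcases max_choice 0 T' with h | h <;> rw [h]
      · rw [zero_mul, add_zero, one_mul]
        exact Real.rpow_le_rpow hW hgle hq.le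
      · exact h1
    rw [heff]
    set X := 1 + max 0 T' * rateConst γ r K μ w₀
    have hX : 0 < X := add_pos_of_pos_of_nonneg one_pos (mul_nonneg (le_max_left _ _) hR)
    have h3 := Real.rpow_le_rpow (by positivity) h2 (one_div_pos.2 hq).le
    rw [Real.mul_rpow hX.le (by positivity), ← Real.rpow_mul hW, ← Real.rpow_mul hw₀.le,
      mul_one_div_cancel hq.ne', Real.rpow_one, Real.rpow_one] at h3
    rw [mul_one_div, le_div_iff₀ (by positivity), mul_comm]
    exact h3
  · subst hr2
    have h1 := hrun.rate_two hC hf hγ hε hcurv hK hμ0 hprimal hα₀ hburn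
    rw [hT''] at h1
    rw [heff]
    have h2 : γ / Real.exp (2 * γ) * (max 0 T' / (16 * K * μ)) =
        γ / (16 * Real.exp (2 * γ) * K * μ) * max 0 T' := by
      field_simp
    rw [h2]
    rcases max_choice 0 T' with h | h <;> rw [h]
    · simpa using hgle
    · exact h1

end Rates

end RestartFW

theorem mainTheorem4 {E : Type*} [NormedAddCommGroup E] [NormedSpace ℝ E] [FiniteDimensional ℝ E]
    (C : Set E) (hC : IsPolytope C) (f : E → ℝ) (hf : IsSmoothConvex C f)
    (γ : ℝ) (hγ : 0 < γ) :
    -- a polytope satisfies a scaling inequality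
    (∃ δ : ℝ, 0 < δ ∧ Scaling C δ) ∧
    -- the restart scheme terminates, from every starting point
    (∀ ε : ℝ, 0 < ε → ∃ N : ℕ, ∀ α₀ : E →₀ ℝ, IsActiveRep C α₀ →
      (∀ t α, IsIterate C f γ ε α₀ t α → t ≤ N) ∧ ∃ T α, IsOutput C f γ ε α₀ T α) ∧
    -- rates of the output under the Hölderian error bound, after the burn-in phase
    (∀ θ c δ r μ : ℝ, 0 ≤ θ → θ ≤ 1 → 0 < c → 0 < δ → HEB C f θ c → Scaling C δ →
      r = 1 / (1 - θ) → μ = (c / δ) ^ r →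
      ∀ ε : ℝ, 0 < ε → ∀ α₀ : E →₀ ℝ, IsActiveRep C α₀ →
      Real.exp (-γ) * gap C f α₀ / 2 ≤ awayCurvature C f →
      ∀ T α, IsOutput C f γ ε α₀ T α →
        (1 ≤ r → r < 2 →
          f (point α) - optValue C f ≤
            gap C f α₀ * (1 / (1 + effectiveSteps α₀ T α *
              rateConst γ r (awayCurvature C f) μ (gap C f α₀)) ^ (1 / (2 - r)))) ∧
        (r = 2 →
          f (point α) - optValue C f ≤
            gap C f α₀ * Real.exp (-(γ / Real.exp (2 * γ) *
              (effectiveSteps α₀ T α / (16 * awayCurvature C f * μ)))))) ∧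
    -- strongly convex objective: the error bound holds with exponent 1/2, and convergence is linear
    (∀ m : ℝ, 0 < m → StrongConvexOn C m f →
      (∃ c : ℝ, 0 < c ∧ HEB C f (1 / 2) c) ∧
      ∃ M ρ : ℝ, 0 < ρ ∧ ρ < 1 ∧
        ∀ ε : ℝ, 0 < ε → ∀ α₀ : E →₀ ℝ, IsActiveRep C α₀ →
        ∀ t α, IsIterate C f γ ε α₀ t α → f (point α) - optValue C f ≤ M * ρ ^ t) ∧
    -- general smooth convex objective: the error bound holds with exponent 0, and the rate is O(1/t)
    ((∃ c : ℝ, 0 < c ∧ HEB C f 0 c) ∧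
      ∃ M : ℝ, ∀ ε : ℝ, 0 < ε → ∀ α₀ : E →₀ ℝ, IsActiveRep C α₀ →
        ∀ t α, IsIterate C f γ ε α₀ t α → 0 < t → f (point α) - optValue C f ≤ M / t) := by

  refine ⟨hC.exists_scaling, fun ε hε => restart_terminates hC hf hγ hε, ?_, ?_,
    exists_HEB_zero hC.isCompact hf.differentiable, exists_sublinear_rate hC hf hγ⟩
  · intro θ c δ r μ hθ0 hθ1 hc hδ hH hS hr hμ ε hε α₀ hα₀ hburn T α hout
    rcases eq_or_lt_of_le hθ1 with rfl | hθ
    -- For `θ = 1` the convention `1 / 0 = 0` gives `r = 0`, outside both regimes.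
    · rw [sub_self, div_zero] at hr
      subst hr
      exact ⟨fun h => absurd h (by norm_num), fun h => absurd h (by norm_num)⟩
    · have h := output_rate hC hf hγ hθ hc hδ hH hS hr hμ hε hα₀ hburn hout.1
      exact ⟨fun _ => h.1, h.2⟩
  · intro m hm hsc
    obtain ⟨c, hc, hH⟩ := exists_HEB_half_of_strongConvexOn hC.isCompact hf.differentiable hm hsc
    exact ⟨⟨c, hc, hH⟩, exists_linear_rate hC hf hγ hc hH⟩
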